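/- **Setting.** Let $\mathcal X\subset\mathbb R$ be compact with positive Lebesgue measure, $x_1,x_2,\ldots\in\mathcal X$ fixed covariates, and $y_{ij}$ ($i,j\ge 1$) real responses on a probability space $(\Omega,P)$; $\mathbf X_n=(x_1,\ldots,x_n)$, $\mathbf Y_{nm}=(y_{ij})_{i\le n,j\le m}$, $\mathbf y_i=(y_{i1},\ldots,y_{im})$. Fix a $\sigma$-finite measure $\mu$ on $\mathbb R$. A *model* $\mathcal M$ consists of a parameter space $\Theta$ (a measurable space) with a prior probability $\pi$ and of jointly measurable conditional $\mu$-densities $f(\cdot\mid\theta,x,\mathbf Y^{(i-1)})$ of the $i$-th response given the preceding ones; the columns $(y_{1j},y_{2j},\ldots)$ are independent given $\theta$, so that the likelihood is $f(\mathbf Y_{nm}\mid\mathbf X_n,\theta)=\prod_{j\le m}\prod_{i\le n}f(y_{ij}\mid\theta,x_i,y_{1j},\ldots,y_{i-1,j})$. The data follow the marginal law of a true model $\mathcal M_0$ (whose prior may be a point mass), with marginal density $f_0(\mathbf Y_{nm})$. The competing models are $\mathcal M_1,\ldots,\mathcal M_K$, $1<K<\infty$, with parameter spaces $\Theta_k$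 and priors $\pi_k$; $\mathcal M_0$ need not be among them. The parameter $\theta_k$ includes a function $\eta$ of the covariate, and $H$ is a known transformation such that $(\theta_k,x)\mapsto H(\eta(x))$ is measurable. The model index $\zeta$ has $P(\zeta=k\mid p_1,\ldots,p_K)=p_k$, and $(p_1,\ldots,p_K)$ has a prior on the probability simplex. **Conditions (S1)-(S7).** For every $k$ and every fixed $m\ge1$, put $R_n(\theta)=f_k(\mathbf Y_{nm}\mid\mathbf X_n,\theta)/f_0(\mathbf Y_{nm})$, and let $h(\theta)=h_k^{(m)}(\theta)$ be the limit as $n\to\infty$ of $\frac1n$ times the Kullback-Leibler divergence of the law of $\mathbf Y_{nm}$ under $\theta$ from its true law. Put $h(A)=\operatorname{ess\,inf}_{A}h$ with respect to $\pi_k$, and $I=\{h=\infty\}$. Assume: (S1) $R_n(\theta)$ is jointly measurable in $\theta$ and $\mathbf Y_{nm}$; (S2) the limit $h(\theta)\in[0,\infty]$ exists for every $\theta$ and is measurable in $\theta$; (S3) for every $\theta$, $\frac1n\log R_n(\theta)\to-h(\theta)$ a.s.; (S4) $\pi_k(I)<1$; and there are measurable sets $\mathcal G_n\to\Theta_k$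 (every $\theta$ lies in $\mathcal G_n$ for all large $n$) such that (S5) (1) $\pi_k(\mathcal G_n^c)\le b e^{-\gamma n}$ for some $b>0$, $\gamma>2h(\Theta_k)$; (2) a.s., for every $\epsilon>0$ and all large $n$: $|\frac1n\log R_n(\theta)+h(\theta)|\le\epsilon$ for all $\theta\in\mathcal G_n\setminus I$ and $\frac1n\log R_n(\theta)\le-1/\epsilon$ for all $\theta\in\mathcal G_n\cap I$; (3) $h(\mathcal G_n)\to h(\Theta_k)$; (S6) for every $\delta>0$, a.s. for all large $n$ and all $t\ge n$: $\frac1t\log\int_{\mathcal G_n}R_t\,d\pi_k\le\delta+\limsup_{s\to\infty}\frac1s\log\int_{\mathcal G_n}R_s\,d\pi_k$; (S7) $h(\mathcal G_n\cap A)\to h(A)$ for every measurable $A$ with $\pi_k(A)>0$. **Best model.** Let $\tilde k$ be the unique minimizer of $h_k^{(m)}(\Theta_k)$ over $k$, the same for all $m\ge1$, with $E(p_{\tilde k})>0$ under the prior. Let $\tilde\Theta_k\subseteq\Theta_k$ be measurable with $h_k^{(m)}(\tilde\Theta_k^c)>h_k^{(m)}(\Theta_k)$ for all $k$ and all $m\ge1$.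 **Hypotheses tested.** Given $\theta_k$, the unknown covariate $\tilde x_i$ has the uniform prior on $B_{im}(\theta_k)=\{x\in\mathcal X: H(\eta(x))\in[\bar y_i-\frac{c_0s_i}{\sqrt m},\bar y_i+\frac{c_0s_i}{\sqrt m}]\}$, where $c_0\ge1$, $\bar y_i$ and $s_i$ are the mean and the standard deviation (divisor $m-1$) of $\mathbf y_i$, and $B_{im}(\theta_k)$ is replaced by $\mathcal X$ when it is Lebesgue-null. The restricted cross-validation posterior of $\tilde x_i$ is the law on $\mathcal X$ with density proportional to $$\tilde x\mapsto\int_{\tilde\Theta_k}f_k(\mathbf Y_{nm}\mid x_1,\ldots,x_{i-1},\tilde x,x_{i+1},\ldots,x_n,\theta_k)\,\pi(\tilde x_i=\tilde x\mid\theta_k)\,d\pi_k(\theta_k);$$ assume that, a.s., its normalizing constants are positive and finite for all $k$, all $n,m>1$ and all $i\le n$. Under the posterior of $\tilde{\mathbf X}_n=(\tilde x_1,\ldots,\tilde x_n)$ the $\tilde x_i$ are independent with these laws. With $E_i$, $V_i$ the mean and the variance of the law of $\tilde x_i$, and $c>0$ fixed, let $T^{(k)}(\mathbf v)$ be either $\frac1n\sum_{i\le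 n}\frac{|v_i-E_i|}{\sqrt{V_i+c}}$ or $\frac1n\sum_{i\le n}\frac{(v_i-E_i)^2}{V_i+c}$. Let $a_k$ be the constant with $\lim_{m\to\infty}\lim_{n\to\infty}T^{(k)}(\mathbf X_n)=a_k$ a.s., which is assumed to exist, and let $[\tilde\ell_{knm},\tilde u_{knm}]$ have, a.s. for all $k$ and all $n,m>1$, posterior probability at least $1-\alpha$ for $T^{(k)}(\tilde{\mathbf X}_n)$, where $\alpha\in(0,1)$ is fixed. Fix $\varepsilon>0$ and consider $$H_{0k}:\ \zeta=k,\ \theta_k\in\tilde\Theta_k,\ T^{(k)}(\tilde{\mathbf X}_n)-T^{(k)}(\mathbf X_n)\in[\tilde\ell_{knm}-a_k-\varepsilon,\ \tilde u_{knm}-a_k+\varepsilon]$$ against its complement $H_{1k}$. The posterior probability of $H_{1k}$ is $$v_{knm}=\pi(\zeta\ne k\mid\text{data})+\pi(\zeta=k\mid\text{data})\,\pi(\theta_k\notin\tilde\Theta_k\mid\text{data},\mathcal M_k)+\pi(\zeta=k\mid\text{data})\,\pi(\theta_k\in\tilde\Theta_k\mid\text{data},\mathcal M_k)\,q_{knm},$$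 where $q_{knm}$ is the posterior probability that $T^{(k)}(\tilde{\mathbf X}_n)-T^{(k)}(\mathbf X_n)\notin[\tilde\ell_{knm}-a_k-\varepsilon,\tilde u_{knm}-a_k+\varepsilon]$. Let $\beta_{nm}=\lambda_{nm}/(1+\lambda_{nm})$ with $\lambda_{nm}>0$. The Bayesian multiple testing procedure rejects $H_{0k}$ if and only if $v_{knm}>\beta_{nm}$; this maximizes $\sum_kd_k(v_{knm}-\beta_{nm})$ over $d\in\{0,1\}^K$. Let $\delta(d\mid\mathbf X_n,\mathbf Y_{nm})\in\{0,1\}$ indicate that $d$ is the resulting vector of decisions ($d_k=1$: rejection of $H_{0k}$). **Theorem.** Assume all of the above and condition (A1): $\liminf_{m,n\to\infty}\beta_{nm}>0$ and $\limsup_{m,n\to\infty}\beta_{nm}<1$. Then the procedure is asymptotically optimal: for the vector $\tilde d$ with $\tilde d_k=1$ for $k\ne\tilde k$ and $\tilde d_{\tilde k}=0$, $$\lim_{m\to\infty}\lim_{n\to\infty}\delta(\tilde d\mid\mathbf X_n,\mathbf Y_{nm})=1\quad\text{almost surely,}$$ that is, a.s., for all large $m$ and then all large $n$, it rejects $H_{0k}$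 for every $k\ne\tilde k$ and accepts $H_{0\tilde k}$. -/

import Mathlib

open MeasureTheory ProbabilityTheory Filter Topology Set
open scoped ENNReal

/-! ### Posterior convergence conditions for dependent data and misspecified models -/

/-- The Kullback-Leibler divergence rate `h(θ) = lim_n KL_n(θ) / n`, where `KL_n(θ)` is the
divergence of the law of the first `n` observations under `θ` from their true law. -/
noncomputable def klRate {Θ : Type*} (kl : ℕ → Θ → ℝ≥0∞) (θ : Θ) : ℝ≥0∞ :=
  liminf (fun n : ℕ => kl n θ / (n : ℝ≥0∞)) atTop

/-- `h(A)`: the essential infimum of `h` over `A`, with respect to the prior. -/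
noncomputable def essInfOn {Θ : Type*} [MeasurableSpace Θ] (prior : Measure Θ) (h : Θ → ℝ≥0∞)
    (A : Set Θ) : ℝ≥0∞ :=
  essInf h (prior.restrict A)

/-- `n⁻¹ log R`, an extended real number. -/
noncomputable def logRate (n : ℕ) (R : ℝ≥0∞) : EReal :=
  (((n : ℝ)⁻¹ : ℝ) : EReal) * ENNReal.log R

/-- `L` is `ε`-close to `-h`; where `h = ∞` this means that `L` is below `-1/ε`. -/
def CloseToNeg (ε : ℝ) (L : EReal) (h : ℝ≥0∞) : Prop :=
  (h ≠ ⊤ → -(h : EReal) - (ε : EReal) ≤ L ∧ L ≤ -(h : EReal) + (ε : EReal)) ∧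
  (h = ⊤ → L ≤ ((-(1 / ε) : ℝ) : EReal))

/-- Shalizi's conditions (S1)-(S7). Here `P` is the true distribution, `ℱ n` is the sigma-field
generated by the first `n` observations, `R n θ` is the likelihood ratio of `θ` against the truth
based on these observations, and `kl n θ` the divergence of `θ` from the truth. -/
structure ShaliziConditions {Ω Θ : Type*} [MeasurableSpace Ω] [mΘ : MeasurableSpace Θ]
    (P : Measure Ω) (ℱ : ℕ → MeasurableSpace Ω) (prior : Measure Θ)
    (R : ℕ → Θ → Ω → ℝ≥0∞) (kl : ℕ → Θ → ℝ≥0∞) : Prop where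
  /-- (S1) joint measurability of the likelihood ratio -/
  s1 : ∀ n, Measurable[MeasurableSpace.prod mΘ (ℱ n)] fun p : Θ × Ω => R n p.1 p.2
  /-- (S2) the divergence rate exists, possibly being infinite, and is measurable -/
  s2 : (∀ θ, Tendsto (fun n : ℕ => kl n θ / (n : ℝ≥0∞)) atTop (𝓝 (klRate kl θ))) ∧
    Measurable (klRate kl)
  /-- (S3) the relative asymptotic equipartition property -/
  s3 : ∀ θ, ∀ᵐ ω ∂P, Tendsto (fun n => logRate n (R n θ ω)) atTop (𝓝 (-(klRate kl θ : EReal)))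
  /-- (S4) the prior does not charge `{h = ∞}` fully -/
  s4 : prior {θ | klRate kl θ = ⊤} < 1
  /-- (S5)-(S7) the sieves -/
  s567 : ∃ G : ℕ → Set Θ, (∀ n, MeasurableSet (G n)) ∧ (∀ θ, ∀ᶠ n in atTop, θ ∈ G n) ∧
    -- (S5)(1)
    (∃ b γ : ℝ, 0 < b ∧ 0 < γ ∧ 2 * essInfOn prior (klRate kl) univ < ENNReal.ofReal γ ∧
      ∀ n : ℕ, prior (G n)ᶜ ≤ ENNReal.ofReal (b * Real.exp (-γ * n))) ∧
    -- (S5)(2)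
    (∀ᵐ ω ∂P, ∀ ε : ℝ, 0 < ε → ∀ᶠ n in atTop, ∀ θ ∈ G n,
      CloseToNeg ε (logRate n (R n θ ω)) (klRate kl θ)) ∧
    -- (S5)(3)
    Tendsto (fun n => essInfOn prior (klRate kl) (G n)) atTop
      (𝓝 (essInfOn prior (klRate kl) univ)) ∧
    -- (S6)
    (∀ δ : ℝ, 0 < δ → ∀ᵐ ω ∂P, ∀ᶠ n in atTop, ∀ t ≥ n,
      logRate t (∫⁻ θ in G n, R t θ ω ∂prior) ≤
        (δ : EReal) + limsup (fun s => logRate s (∫⁻ θ in G n, R s θ ω ∂prior)) atTop) ∧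
    -- (S7)
    (∀ A : Set Θ, MeasurableSet A → 0 < prior A →
      Tendsto (fun n => essInfOn prior (klRate kl) (G n ∩ A)) atTop
        (𝓝 (essInfOn prior (klRate kl) A)))

/-! ### Regression models -/

/-- A regression model with covariates in `𝒳` and responses having densities with respect to `μ`:
`dens i θ x past` is the density `f(· | θ, x, past)` of the response number `i` (counted from `0`)
at the covariate value `x`, given the `i` preceding responses of the same replicate; the parameter
`θ` has a prior distribution. -/
structure RegModel (𝒳 : Set ℝ) (μ : Measure ℝ) (Θ : Type*) [MeasurableSpace Θ] where
  dens : (i : ℕ) → Θ → ℝ → (Fin i → ℝ) → ℝ → ℝ≥0∞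
  measurable_dens : ∀ i, Measurable fun p : Θ × ℝ × (Fin i → ℝ) × ℝ =>
    dens i p.1 p.2.1 p.2.2.1 p.2.2.2
  lintegral_dens : ∀ i θ, ∀ x ∈ 𝒳, ∀ past, ∫⁻ y, dens i θ x past y ∂μ = 1
  prior : Measure Θ
  isProbabilityMeasure_prior : IsProbabilityMeasure prior

/-- A competing model: a regression model with parameter `θ = (η, ξ)`, where `η = eta θ` is a
function of the covariate, together with the transformation `H = link` of `η` which is used in the
prior for the unknown covariate. -/
structure InvModel (𝒳 : Set ℝ) (μ : Measure ℝ) (Θ : Type*) [MeasurableSpace Θ]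
    extends RegModel 𝒳 μ Θ where
  eta : Θ → ℝ → ℝ
  link : ℝ → ℝ
  measurable_link_eta : Measurable fun p : Θ × ℝ => link (eta p.1 p.2)

namespace RegModel

variable {𝒳 : Set ℝ} {μ : Measure ℝ} {Θ : Type*} [MeasurableSpace Θ] (M : RegModel 𝒳 μ Θ)
  {n m : ℕ}

/-- The likelihood `f(Y_nm | X_n, θ)`; row `i` of `Y` holds the `m` replicates `y_i1, …, y_im` of
the response at `x i`, and the replicates are independent given `θ`. -/
noncomputable def lik (x : Fin n → ℝ) (θ : Θ) (Y : Fin n → Fin m → ℝ) : ℝ≥0∞ :=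
  ∏ j : Fin m, ∏ i : Fin n,
    M.dens i θ (x i) (fun l : Fin i => Y (Fin.castLE i.isLt.le l) j) (Y i j)

/-- The marginal density of `Y_nm` under the model. -/
noncomputable def marg (x : Fin n → ℝ) (Y : Fin n → Fin m → ℝ) : ℝ≥0∞ :=
  ∫⁻ θ, M.lik x θ Y ∂M.prior

/-- The distribution of `Y_nm` under the parameter `θ`. -/
noncomputable def law (x : Fin n → ℝ) (m : ℕ) (θ : Θ) : Measure (Fin n → Fin m → ℝ) :=
  (Measure.pi fun _ => Measure.pi fun _ => μ).withDensity (M.lik x θ)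

/-- The distribution of `Y_nm` under the model, the parameter being drawn from its prior. -/
noncomputable def margLaw (x : Fin n → ℝ) (m : ℕ) : Measure (Fin n → Fin m → ℝ) :=
  (Measure.pi fun _ => Measure.pi fun _ => μ).withDensity (M.marg x)

/-- The posterior probability `π(θ ∈ A | X_n, Y_nm)` under the model. -/
noncomputable def post (x : Fin n → ℝ) (Y : Fin n → Fin m → ℝ) (A : Set Θ) : ℝ≥0∞ :=
  (∫⁻ θ in A, M.lik x θ Y ∂M.prior) / M.marg x Y

end RegModel

/-- The mean `ȳ_i` of the replicates. -/
noncomputable def ybar {m : ℕ} (r : Fin m → ℝ) : ℝ := (∑ j, r j) / m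

/-- The standard deviation `s_i` of the replicates (divisor `m - 1`). -/
noncomputable def sdev {m : ℕ} (r : Fin m → ℝ) : ℝ :=
  √((∑ j, (r j - ybar r) ^ 2) / ((m : ℝ) - 1))

/-- The two discrepancy measures. -/
inductive Disc
  | abs
  | sq

namespace InvModel

variable {𝒳 : Set ℝ} {μ : Measure ℝ} {Θ : Type*} [MeasurableSpace Θ] (M : InvModel 𝒳 μ Θ)
  {n m : ℕ}

/-- The set `B_im(θ) = {x ∈ 𝒳 : H(η(x)) ∈ [ȳ_i - c s_i / √m, ȳ_i + c s_i / √m]}`. -/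
def B (c : ℝ) (θ : Θ) (r : Fin m → ℝ) : Set ℝ :=
  {x ∈ 𝒳 | M.link (M.eta θ x) ∈ Icc (ybar r - c * sdev r / √m) (ybar r + c * sdev r / √m)}

open Classical in
/-- The support of the prior for `x̃_i`: the set `B_im(θ)`, or the whole covariate space in the
degenerate case where `B_im(θ)` is Lebesgue-null and carries no uniform distribution. -/
noncomputable def xSupp (c : ℝ) (θ : Θ) (r : Fin m → ℝ) : Set ℝ :=
  if volume (M.B c θ r) = 0 then 𝒳 else M.B c θ r

/-- The density `π(x̃_i | θ)` of the uniform prior for `x̃_i`. -/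
noncomputable def xPrior (c : ℝ) (θ : Θ) (r : Fin m → ℝ) : ℝ → ℝ≥0∞ :=
  (M.xSupp c θ r).indicator fun _ => (volume (M.xSupp c θ r))⁻¹

/-- The density of the cross-validation posterior of `x̃_i` restricted to `θ ∈ Θt`, up to its
normalizing constant: the covariate value `x i` is replaced by the unknown `x̃_i`, which has its
uniform prior given `θ`, and `θ ∈ Θt` is integrated out. -/
noncomputable def cvNum (c : ℝ) (x : Fin n → ℝ) (Y : Fin n → Fin m → ℝ) (Θt : Set Θ) (i : Fin n)
    (xt : ℝ) : ℝ≥0∞ :=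
  ∫⁻ θ in Θt, M.lik (Function.update x i xt) θ Y * M.xPrior c θ (Y i) xt ∂M.prior

/-- The normalizing constant of the cross-validation posterior of `x̃_i`. -/
noncomputable def cvNorm (c : ℝ) (x : Fin n → ℝ) (Y : Fin n → Fin m → ℝ) (Θt : Set Θ)
    (i : Fin n) : ℝ≥0∞ :=
  ∫⁻ xt in 𝒳, M.cvNum c x Y Θt i xt

/-- The cross-validation posterior `π(x̃_i | X_{n,-i}, Y_nm, M, Θt)`. -/
noncomputable def cvPost (c : ℝ) (x : Fin n → ℝ) (Y : Fin n → Fin m → ℝ) (Θt : Set Θ)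
    (i : Fin n) : Measure ℝ :=
  (M.cvNorm c x Y Θt i)⁻¹ • (volume.restrict 𝒳).withDensity (M.cvNum c x Y Θt i)

/-- The posterior distribution of `X̃_n = (x̃_1, …, x̃_n)`: the coordinates are independent, and
each has its cross-validation posterior. -/
noncomputable def xTildePost (c : ℝ) (x : Fin n → ℝ) (Y : Fin n → Fin m → ℝ) (Θt : Set Θ) :
    Measure (Fin n → ℝ) :=
  Measure.pi fun i => M.cvPost c x Y Θt i

/-- The discrepancy measures `T_1` and `T_2` at `v`; `c'` is the stabilizing constant. -/
noncomputable def T (D : Disc) (c c' : ℝ) (x : Fin n → ℝ) (Y : Fin n → Fin m → ℝ) (Θt : Set Θ)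
    (v : Fin n → ℝ) : ℝ :=
  match D with
  | .abs => (1 / (n : ℝ)) * ∑ i, |v i - ∫ z, z ∂M.cvPost c x Y Θt i| /
      √(Var[id; M.cvPost c x Y Θt i] + c')
  | .sq => (1 / (n : ℝ)) * ∑ i, (v i - ∫ z, z ∂M.cvPost c x Y Θt i) ^ 2 /
      (Var[id; M.cvPost c x Y Θt i] + c')

end InvModel

/-! ### Multiple testing -/

section Testing

variable {𝒳 : Set ℝ} {μ : Measure ℝ} {K : ℕ} {Θ : Fin K → Type*} [∀ k, MeasurableSpace (Θ k)]
  {n m : ℕ}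

/-- The posterior probability `π(ζ = k | X_n, Y_nm)` of model `k`, where `ζ` is drawn from
`(p_1, …, p_K)` and this vector of probabilities has the prior distribution `ρ`. -/
noncomputable def postModel (M : ∀ k, InvModel 𝒳 μ (Θ k)) (ρ : Measure (Fin K → ℝ))
    (x : Fin n → ℝ) (Y : Fin n → Fin m → ℝ) (k : Fin K) : ℝ≥0∞ :=
  (∫⁻ p, ENNReal.ofReal (p k) * (M k).marg x Y ∂ρ) /
    ∑ l, ∫⁻ p, ENNReal.ofReal (p l) * (M l).marg x Y ∂ρ

/-- The posterior probability `v_knm` of the alternative hypothesis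
`H_1k = {ζ ≠ k} ∪ {ζ = k, θ_k ∉ Θ̃_k} ∪ {ζ = k, θ_k ∈ Θ̃_k, T(X̃_n) - T(X_n) ∉ [lo, up]}`;
given `ζ = k` and `θ_k ∈ Θ̃_k`, the vector `X̃_n` has the posterior restricted to `Θ̃_k`. -/
noncomputable def postAlt (M : ∀ k, InvModel 𝒳 μ (Θ k)) (ρ : Measure (Fin K → ℝ))
    (Θt : ∀ k, Set (Θ k)) (D : Fin K → Disc) (c c' : ℝ) (lo up : Fin K → ℝ)
    (x : Fin n → ℝ) (Y : Fin n → Fin m → ℝ) (k : Fin K) : ℝ :=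
  ((∑ l ∈ Finset.univ.erase k, postModel M ρ x Y l) +
    postModel M ρ x Y k * (M k).post x Y (Θt k)ᶜ +
    postModel M ρ x Y k * (M k).post x Y (Θt k) *
      (M k).xTildePost c x Y (Θt k)
        {v | (M k).T (D k) c c' x Y (Θt k) v - (M k).T (D k) c c' x Y (Θt k) x ∉
          Icc (lo k) (up k)}).toReal

/-- The criterion `f_β(d) = ∑_k d_k (v_k - β)`. -/
noncomputable def criterion (v : Fin K → ℝ) (β : ℝ) (d : Fin K → Bool) : ℝ :=
  ∑ k, if d k then v k - β else 0

open Classical in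
/-- The optimal decision configuration: reject the hypothesis `k` if and only if `v_k > β`. -/
noncomputable def optimalDecision (v : Fin K → ℝ) (β : ℝ) : Fin K → Bool :=
  fun k => decide (β < v k)

theorem criterion_le_optimalDecision (v : Fin K → ℝ) (β : ℝ) (d : Fin K → Bool) :
    criterion v β d ≤ criterion v β (optimalDecision v β) := by
  unfold criterion optimalDecision
  refine Finset.sum_le_sum fun k _ => ?_
  by_cases h : β < v k
  · by_cases hd : d k <;> simp [h, hd]
    exact h.le
  · by_cases hd : d k <;> simp [h, hd]
    exact not_lt.mp h

/-- `δ(d | X_n, Y_nm)`: the (degenerate) probability that `d` is the chosen configuration. -/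
noncomputable def decisionRule (v : Fin K → ℝ) (β : ℝ) (d : Fin K → Bool) : ℝ :=
  if d = optimalDecision v β then 1 else 0

/-- The configuration which accepts `H_0k̃` and rejects all the other null hypotheses. -/
def bestDecision (kt : Fin K) : Fin K → Bool := fun k => decide (k ≠ kt)

end Testing

/-- The iterated limit `lim_{m → ∞} lim_{n → ∞} u n m = a`. -/
def IterLim (u : ℕ → ℕ → ℝ) (a : ℝ) : Prop :=
  ∃ L : ℕ → ℝ, (∀ᶠ m in atTop, Tendsto (fun n => u n m) atTop (𝓝 (L m))) ∧
    Tendsto L atTop (𝓝 a)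

/-- Asymptotic optimality of a decision rule: `lim_m lim_n δ(d̃ | X_n, Y_nm) = 1` almost surely. -/
def AsymptoticallyOptimal {Ω : Type*} [MeasurableSpace Ω] {K : ℕ} (P : Measure Ω)
    (δ : ℕ → ℕ → Ω → (Fin K → Bool) → ℝ) (kt : Fin K) : Prop :=
  ∀ᵐ ω ∂P, IterLim (fun n m => δ n m ω (bestDecision kt)) 1

/-! ### The data -/

/-- The covariates `X_n`. -/
def covariates (x : ℕ → ℝ) (n : ℕ) : Fin n → ℝ := fun i => x i

/-- The responses `Y_nm`. -/
def responses {Ω : Type*} (y : ℕ → ℕ → Ω → ℝ) (n m : ℕ) (ω : Ω) : Fin n → Fin m → ℝ :=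
  fun i j => y i j ω

/-- The divergence of the law of `Y_nm` under the parameter `θ` from its law under the true
model. -/
noncomputable def klFromTruth {𝒳 : Set ℝ} {μ : Measure ℝ} {Θ₀ Θ : Type*} [MeasurableSpace Θ₀]
    [MeasurableSpace Θ] (M₀ : RegModel 𝒳 μ Θ₀) (M : RegModel 𝒳 μ Θ) (x : ℕ → ℝ) (m n : ℕ)
    (θ : Θ) : ℝ≥0∞ :=
  InformationTheory.klDiv (M₀.margLaw (covariates x n) m) (M.law (covariates x n) m θ)

/-- `h_k(A)` for the experiment with `m` replicates: the essential infimum over `A` of the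
divergence rate (as `n → ∞`) from the true model. -/
noncomputable def minKLRate {𝒳 : Set ℝ} {μ : Measure ℝ} {Θ₀ Θ : Type*} [MeasurableSpace Θ₀]
    [MeasurableSpace Θ] (M₀ : RegModel 𝒳 μ Θ₀) (M : RegModel 𝒳 μ Θ) (x : ℕ → ℝ) (m : ℕ)
    (A : Set Θ) : ℝ≥0∞ :=
  essInfOn M.prior (klRate (klFromTruth M₀ M x m)) A

/-- Shalizi's conditions for the model `M`, for the experiment with `m` replicates and an
increasing number `n` of covariate values. -/
def SatisfiesShalizi {Ω : Type*} [MeasurableSpace Ω] (P : Measure Ω) {𝒳 : Set ℝ} {μ : Measure ℝ}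
    {Θ₀ Θ : Type*} [MeasurableSpace Θ₀] [MeasurableSpace Θ] (M₀ : RegModel 𝒳 μ Θ₀)
    (M : RegModel 𝒳 μ Θ) (x : ℕ → ℝ) (y : ℕ → ℕ → Ω → ℝ) (m : ℕ) : Prop :=
  ShaliziConditions P
    (fun n => MeasurableSpace.comap (responses y n m) inferInstance)
    M.prior
    (fun n θ ω => M.lik (covariates x n) θ (responses y n m ω) /
      M₀.marg (covariates x n) (responses y n m ω))
    (klFromTruth M₀ M x m)

/-! For fixed `m` the argument compares exponential rates of integrated likelihood ratios. The
sieves carry almost all prior mass, and on them `R n θ` is uniformly about `exp (-n h(θ))`.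
Integrating over parameters with `h` close to its essential infimum gives a lower bound at every
rate above `h(Θ)` (`eventually_exp_le_lintegral`). Over a set `A`, the part inside the sieves decays
at every rate below `h(A)`; the part outside decays at every rate below `γ`, because the likelihood
ratio has expectation at most 1 and the prior tail is summable after exponential weighting
(`exists_ae_eventually_setLIntegral_le`). Since `γ` exceeds `h(Θ)`, sets with a larger divergence
rate have vanishing posterior odds (`ae_tendsto_lintegral_div`). Hence the model posterior
concentrates on `kt`, and inside that model the posterior of the complement of `Θt kt` vanishes.

The discrepancy of the unknown covariates is an average of independent terms, uniformly bounded
because `𝒳` is compact, so Chebyshev's inequality concentrates it at its mean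
(`exists_xTildePost_le`). A credible interval has mass at least `1 - α`, so it must meet the
concentration window. Enlarging it by `ε`, and using that the observed discrepancy is close to `a`,
captures all but a vanishing mass (`measure_sub_notMem_Icc_le`).

Thus the alternative for `kt` has posterior probability tending to 0, while every other alternative
contains the event `ζ = kt`, of posterior probability tending to 1. Thresholds bounded away from 0
and 1 separate the two cases. -/

/-! ### Logarithmic rates and exponential bounds -/

theorem EReal.coe_inv_natCast_mul_le_iff {n : ℕ} (hn : 0 < n) (s : ℝ) (L : EReal) :
    (((n : ℝ)⁻¹ : ℝ) : EReal) * L ≤ (s : EReal) ↔ L ≤ ((n * s : ℝ) : EReal) := by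
  have hn' : (0 : ℝ) < n := by exact_mod_cast hn
  induction L with
  | bot => rw [EReal.coe_mul_bot_of_pos (by positivity)]; simp
  | coe a =>
    rw [← EReal.coe_mul, EReal.coe_le_coe_iff, EReal.coe_le_coe_iff, inv_mul_le_iff₀ hn']
  | top =>
    rw [EReal.coe_mul_top_of_pos (by positivity)]
    simp only [top_le_iff, EReal.coe_ne_top]

theorem EReal.le_coe_inv_natCast_mul_iff {n : ℕ} (hn : 0 < n) (s : ℝ) (L : EReal) :
    (s : EReal) ≤ (((n : ℝ)⁻¹ : ℝ) : EReal) * L ↔ ((n * s : ℝ) : EReal) ≤ L := by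
  have hn' : (0 : ℝ) < n := by exact_mod_cast hn
  induction L with
  | bot =>
    rw [EReal.coe_mul_bot_of_pos (by positivity)]
    simp only [le_bot_iff, EReal.coe_ne_bot]
  | coe a =>
    rw [← EReal.coe_mul, EReal.coe_le_coe_iff, EReal.coe_le_coe_iff, le_inv_mul_iff₀ hn']
  | top => rw [EReal.coe_mul_top_of_pos (by positivity)]; simp

theorem ENNReal.log_ofReal_exp (s : ℝ) : ENNReal.log (ENNReal.ofReal (Real.exp s)) = s := by
  rw [ENNReal.log_ofReal_of_pos (Real.exp_pos s), Real.log_exp]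

/-- Trades rates for exponential bounds, with `R = 0` and `R = ⊤` included. At `n = 0` the rate
degenerates to 0, hence `0 < n`. -/
theorem logRate_le_iff {n : ℕ} (hn : 0 < n) (s : ℝ) (R : ℝ≥0∞) :
    logRate n R ≤ (s : EReal) ↔ R ≤ ENNReal.ofReal (Real.exp (n * s)) := by
  rw [logRate, EReal.coe_inv_natCast_mul_le_iff hn, ← ENNReal.log_ofReal_exp,
    ENNReal.log_le_log_iff]

theorem le_logRate_iff {n : ℕ} (hn : 0 < n) (s : ℝ) (R : ℝ≥0∞) :
    (s : EReal) ≤ logRate n R ↔ ENNReal.ofReal (Real.exp (n * s)) ≤ R := by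
  rw [logRate, EReal.le_coe_inv_natCast_mul_iff hn, ← ENNReal.log_ofReal_exp,
    ENNReal.log_le_log_iff]

/-- Below a threshold strictly smaller than `h`, closeness to `-h` gives a uniform upper bound. -/
theorem CloseToNeg.le_neg {ε s : ℝ} {L : EReal} {h H : ℝ≥0∞} (hL : CloseToNeg ε L h) (hH : H ≤ h)
    (hs : ((s + ε : ℝ) : EReal) ≤ H) (hε : s ≤ 1 / ε) : L ≤ ((-s : ℝ) : EReal) := by
  by_cases h' : h = ⊤
  · exact (hL.2 h').trans (EReal.coe_le_coe_iff.2 (by linarith))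
  · refine (hL.1 h').2.trans ?_
    lift h to NNReal using h'
    have h1 : ((s + ε : ℝ) : EReal) ≤ ((h : ℝ≥0∞) : EReal) :=
      hs.trans (EReal.coe_ennreal_le_coe_ennreal_iff.2 hH)
    have h2 : ((h : ℝ≥0∞) : EReal) = ((h : ℝ) : EReal) := rfl
    rw [h2] at h1 ⊢
    rw [EReal.coe_le_coe_iff] at h1
    rw [← EReal.coe_neg, ← EReal.coe_add, EReal.coe_le_coe_iff]
    linarith

theorem CloseToNeg.neg_le {ε s : ℝ} {L : EReal} {h : ℝ≥0∞} (hL : CloseToNeg ε L h)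
    (hs : h ≤ ENNReal.ofReal s) (hs0 : 0 ≤ s) : ((-(s + ε) : ℝ) : EReal) ≤ L := by
  have h' : h ≠ ⊤ := ne_top_of_le_ne_top ENNReal.ofReal_ne_top hs
  refine le_trans ?_ (hL.1 h').1
  lift h to NNReal using h'
  have h2 : ((h : ℝ≥0∞) : EReal) = ((h : ℝ) : EReal) := rfl
  have h3 : (h : ℝ) ≤ s := by
    have := ENNReal.toReal_mono ENNReal.ofReal_ne_top hs
    rwa [ENNReal.toReal_ofReal hs0] at this
  rw [h2, ← EReal.coe_neg, ← EReal.coe_sub, EReal.coe_le_coe_iff]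
  linarith

/-! ### Exponential bounds for integrated likelihood ratios -/

namespace ShaliziConditions

variable {Ω Θ : Type*} [mΩ : MeasurableSpace Ω] [MeasurableSpace Θ] {P : Measure Ω}
  {ℱ : ℕ → MeasurableSpace Ω} {prior : Measure Θ} {R : ℕ → Θ → Ω → ℝ≥0∞} {kl : ℕ → Θ → ℝ≥0∞}

/-- A sublevel set of `h` just above the essential infimum has positive prior mass, and the sieves
eventually keep half of it. On that part the likelihood ratio is uniformly bounded below. -/
theorem exists_lt_le_lintegral [IsProbabilityMeasure prior]
    (hS : ShaliziConditions P ℱ prior R kl) {s : ℝ}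
    (hs : essInfOn prior (klRate kl) univ < ENNReal.ofReal s) :
    ∀ᵐ ω ∂P, ∃ r < s, ∃ C : ℝ≥0∞, 0 < C ∧ ∀ᶠ n : ℕ in atTop,
      ENNReal.ofReal (Real.exp (-(n * r))) * C ≤ ∫⁻ θ, R n θ ω ∂prior := by
  obtain ⟨G, hG, -, ⟨b, γ, -, hγ, -, hGc⟩, hclose, -⟩ := hS.s567
  obtain ⟨s', h1, h2⟩ := ENNReal.lt_iff_exists_real_btwn.1 hs
  obtain ⟨hs'0, h1, h2⟩ := And.intro h1 h2
  have hss : s' < s := ENNReal.ofReal_lt_ofReal_iff'.1 h2 |>.1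
  set A : Set Θ := {θ | klRate kl θ < ENNReal.ofReal s'} with hA
  have hAm : MeasurableSet A := measurableSet_lt hS.s2.2 measurable_const
  have hA0 : prior A ≠ 0 := by
    intro h0
    refine absurd h1 (not_lt.2 (le_essInf_of_ae_le _ ?_))
    rw [Measure.restrict_univ]
    filter_upwards [measure_eq_zero_iff_ae_notMem.1 h0] with θ hθ
    exact not_lt.1 hθ
  have hlim : Tendsto (fun n : ℕ => ENNReal.ofReal (b * Real.exp (-γ * n))) atTop (𝓝 0) := by
    rw [← ENNReal.ofReal_zero]
    refine ENNReal.tendsto_ofReal ?_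
    rw [← mul_zero b]
    refine Tendsto.const_mul b (Real.tendsto_exp_atBot.comp ?_)
    exact tendsto_natCast_atTop_atTop.const_mul_atTop_of_neg (by linarith)
  have hhalf : ∀ᶠ n in atTop, prior A / 2 ≤ prior (G n ∩ A) := by
    filter_upwards [hlim.eventually_lt_const (ENNReal.half_pos hA0)] with n hn
    have h3 : prior A ≤ prior (G n ∩ A) + prior (G n)ᶜ := by
      refine (measure_mono fun θ hθ => ?_).trans (measure_union_le _ _)
      by_cases h : θ ∈ G n
      · exact Or.inl ⟨h, hθ⟩
      · exact Or.inr h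
    have h4 : prior A / 2 + prior A / 2 ≤ prior (G n ∩ A) + prior A / 2 := by
      rw [ENNReal.add_halves]
      exact h3.trans (by gcongr; exact (hGc n).trans hn.le)
    exact (ENNReal.add_le_add_iff_right (ENNReal.div_ne_top (measure_ne_top _ _) (by simp))).1 h4
  filter_upwards [hclose] with ω hω
  -- The gap between `s'` and `s` is split: half of it is the tolerance in the uniform
  -- approximation, the rest keeps `r < s`.
  refine ⟨s' + (s - s') / 2, by linarith, prior A / 2, ENNReal.half_pos hA0, ?_⟩
  filter_upwards [hω ((s - s') / 2) (by linarith), hhalf, eventually_gt_atTop 0] with n hn hn2 hn0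
  calc ENNReal.ofReal (Real.exp (-(n * (s' + (s - s') / 2)))) * (prior A / 2)
      ≤ ENNReal.ofReal (Real.exp (-(n * (s' + (s - s') / 2)))) * prior (G n ∩ A) := by gcongr
    _ = ∫⁻ _ in G n ∩ A, ENNReal.ofReal (Real.exp (-(n * (s' + (s - s') / 2)))) ∂prior := by simp
    _ ≤ ∫⁻ θ in G n ∩ A, R n θ ω ∂prior := by
      refine setLIntegral_mono' ((hG n).inter hAm) fun θ hθ => ?_
      have := (hn θ hθ.1).neg_le (s := s') hθ.2.le hs'0
      rw [le_logRate_iff hn0] at this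
      rwa [← mul_neg]
    _ ≤ ∫⁻ θ, R n θ ω ∂prior := setLIntegral_le_lintegral _ _

/-- Almost surely, the integral of the likelihood ratio is eventually at least `exp (-n s)`. -/
theorem eventually_exp_le_lintegral [IsProbabilityMeasure prior]
    (hS : ShaliziConditions P ℱ prior R kl) {s : ℝ}
    (hs : essInfOn prior (klRate kl) univ < ENNReal.ofReal s) :
    ∀ᵐ ω ∂P, ∀ᶠ n : ℕ in atTop,
      ENNReal.ofReal (Real.exp (-(n * s))) ≤ ∫⁻ θ, R n θ ω ∂prior := by
  filter_upwards [hS.exists_lt_le_lintegral hs] with ω ⟨r, hr, C, hC, hω⟩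
  -- The strict gap `r < s` absorbs the constant `C`.
  have hlim : Tendsto (fun n : ℕ => ENNReal.ofReal (Real.exp (-(n * (s - r))))) atTop (𝓝 0) := by
    rw [← ENNReal.ofReal_zero]
    refine ENNReal.tendsto_ofReal (Real.tendsto_exp_atBot.comp ?_)
    exact tendsto_neg_atTop_atBot.comp (tendsto_natCast_atTop_atTop.atTop_mul_const (by linarith))
  filter_upwards [hω, hlim.eventually_lt_const hC] with n hn hn2
  refine le_trans ?_ hn
  refine le_trans (le_of_eq ?_) (mul_le_mul_right hn2.le _)
  rw [← ENNReal.ofReal_mul (Real.exp_pos _).le, ← Real.exp_add]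
  ring_nf

/-- The integral of the likelihood ratio over the complements of the sieves is negligible. -/
theorem ae_eventually_compl_le [IsProbabilityMeasure P] [IsProbabilityMeasure prior]
    (hℱ : ∀ n, ℱ n ≤ mΩ) (hS : ShaliziConditions P ℱ prior R kl)
    (hR : ∀ n θ, ∫⁻ ω, R n θ ω ∂P ≤ 1) {G : ℕ → Set Θ} {b γ s : ℝ}
    (hGc : ∀ n : ℕ, prior (G n)ᶜ ≤ ENNReal.ofReal (b * Real.exp (-γ * n))) (hs : s < γ) :
    ∀ᵐ ω ∂P, ∀ᶠ n : ℕ in atTop,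
      ∫⁻ θ in (G n)ᶜ, R n θ ω ∂prior ≤ ENNReal.ofReal (Real.exp (-(n * s))) := by
  have hRm (n : ℕ) : Measurable fun p : Θ × Ω => R n p.1 p.2 :=
    (hS.s1 n).mono (sup_le_sup le_rfl (MeasurableSpace.comap_mono (hℱ n))) le_rfl
  have hZm (n : ℕ) : Measurable fun ω => ∫⁻ θ in (G n)ᶜ, R n θ ω ∂prior :=
    (hRm n).lintegral_prod_left'
  have hZ (n : ℕ) : ∫⁻ ω, ∫⁻ θ in (G n)ᶜ, R n θ ω ∂prior ∂P ≤
      ENNReal.ofReal (b * Real.exp (-γ * n)) := by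
    rw [lintegral_lintegral_swap (f := fun ω θ => R n θ ω)
      ((hRm n).comp measurable_swap).aemeasurable]
    calc ∫⁻ θ in (G n)ᶜ, ∫⁻ ω, R n θ ω ∂P ∂prior ≤ ∫⁻ _ in (G n)ᶜ, 1 ∂prior :=
          lintegral_mono fun θ => hR n θ
      _ ≤ _ := by simpa using hGc n
  -- Borel–Cantelli in expectation form: the weighted series has finite mean because `s < γ`, so
  -- almost surely its terms tend to 0 and are eventually at most 1.
  have hsum : ∫⁻ ω, ∑' n : ℕ, ENNReal.ofReal (Real.exp (n * s)) *
      ∫⁻ θ in (G n)ᶜ, R n θ ω ∂prior ∂P ≠ ⊤ := by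
    rw [lintegral_tsum fun n => ((hZm n).const_mul _).aemeasurable]
    have hsm : Summable fun n : ℕ => b * Real.exp (n * (s - γ)) :=
      (Real.summable_exp_nat_mul_iff.2 (by linarith)).mul_left b
    refine ne_top_of_le_ne_top hsm.tsum_ofReal_ne_top (ENNReal.tsum_le_tsum fun n => ?_)
    rw [lintegral_const_mul _ (hZm n)]
    refine (mul_le_mul_right (hZ n) _).trans (le_of_eq ?_)
    rw [← ENNReal.ofReal_mul (Real.exp_pos _).le, mul_left_comm, ← Real.exp_add]
    ring_nf
  filter_upwards [ae_lt_top (Measurable.tsum fun n => (hZm n).const_mul _) hsum] with ω hω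
  filter_upwards [(ENNReal.tendsto_atTop_zero_of_tsum_ne_top hω.ne).eventually_le_const
    zero_lt_one] with n hn
  calc _ = ENNReal.ofReal (Real.exp (-(n * s))) * (ENNReal.ofReal (Real.exp (n * s)) *
        ∫⁻ θ in (G n)ᶜ, R n θ ω ∂prior) := by
        rw [← mul_assoc, ← ENNReal.ofReal_mul (Real.exp_pos _).le, ← Real.exp_add]
        simp
    _ ≤ _ := mul_le_of_le_one_right' hn

/-- Almost surely, the integral of the likelihood ratio over `A` decays exponentially at every rate
below `h(A)` which does not exceed a constant larger than `2 h(Θ)`. -/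
theorem exists_ae_eventually_setLIntegral_le [IsProbabilityMeasure P] [IsProbabilityMeasure prior]
    (hℱ : ∀ n, ℱ n ≤ mΩ) (hS : ShaliziConditions P ℱ prior R kl)
    (hR : ∀ n θ, ∫⁻ ω, R n θ ω ∂P ≤ 1) :
    ∃ γ : ℝ, 0 < γ ∧ 2 * essInfOn prior (klRate kl) univ < ENNReal.ofReal γ ∧
      ∀ A, MeasurableSet A → ∀ s < γ, (s : EReal) < essInfOn prior (klRate kl) A →
        ∀ᵐ ω ∂P, ∀ᶠ n : ℕ in atTop,
          ∫⁻ θ in A, R n θ ω ∂prior ≤ 2 * ENNReal.ofReal (Real.exp (-(n * s))) := by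
  obtain ⟨G, hG, -, ⟨b, γ, -, hγ, hhγ, hGc⟩, hclose, -⟩ := hS.s567
  refine ⟨γ, hγ, hhγ, fun A hA s hs hsA => ?_⟩
  obtain ⟨t, hst, htA⟩ := EReal.lt_iff_exists_real_btwn.1 hsA
  rw [EReal.coe_lt_coe_iff] at hst
  -- The bound `s + ε ≤ t` serves parameters with finite `h`, and `s ≤ 1 / ε` those with `h = ⊤`.
  obtain ⟨ε, hε, hε1, hε2⟩ : ∃ ε : ℝ, 0 < ε ∧ s + ε ≤ t ∧ s ≤ 1 / ε := by
    refine ⟨min (t - s) (1 / (|s| + 1)), lt_min (by linarith) (by positivity), ?_, ?_⟩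
    · linarith [min_le_left (t - s) (1 / (|s| + 1))]
    · have h1 : |s| + 1 ≤ 1 / min (t - s) (1 / (|s| + 1)) := by
        rw [le_one_div (by positivity) (lt_min (by linarith) (by positivity))]
        exact min_le_right _ _
      linarith [le_abs_self s]
  have hae : ∀ᵐ θ ∂prior.restrict A, essInfOn prior (klRate kl) A ≤ klRate kl θ :=
    ae_essInf_le
  filter_upwards [hclose, ae_eventually_compl_le hℱ hS hR hGc hs] with ω hω hω2
  filter_upwards [hω ε hε, hω2, eventually_gt_atTop 0] with n hn hn2 hn0
  have h1 : ∫⁻ θ in A ∩ G n, R n θ ω ∂prior ≤ ENNReal.ofReal (Real.exp (-(n * s))) := by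
    calc ∫⁻ θ in A ∩ G n, R n θ ω ∂prior
        ≤ ∫⁻ _ in A ∩ G n, ENNReal.ofReal (Real.exp (-(n * s))) ∂prior := by
          refine lintegral_mono_ae ?_
          filter_upwards [ae_mono (Measure.restrict_mono inter_subset_left le_rfl) hae,
            ae_restrict_mem (hA.inter (hG n))] with θ hθ hθG
          have := (hn θ hθG.2).le_neg hθ
            ((EReal.coe_le_coe_iff.2 hε1).trans htA.le) hε2
          rwa [logRate_le_iff hn0, mul_neg] at this
      _ ≤ ENNReal.ofReal (Real.exp (-(n * s))) := by
        rw [setLIntegral_const]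
        exact mul_le_of_le_one_right' prob_le_one
  calc ∫⁻ θ in A, R n θ ω ∂prior
      = ∫⁻ θ in A ∩ G n, R n θ ω ∂prior + ∫⁻ θ in A \ G n, R n θ ω ∂prior :=
        (lintegral_inter_add_sdiff _ _ (hG n)).symm
    _ ≤ _ := by
      rw [two_mul]
      exact add_le_add h1 ((lintegral_mono_set fun θ hθ => hθ.2).trans hn2)

end ShaliziConditions

/-! ### Likelihoods and marginals as probability densities -/

theorem MeasureTheory.lintegral_pi_prod_fin {α : Type*} [MeasurableSpace α] (μ : Measure α)
    [SigmaFinite μ] {m : ℕ} (f : Fin m → α → ℝ≥0∞) (hf : ∀ j, Measurable (f j)) :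
    ∫⁻ r, ∏ j, f j (r j) ∂(Measure.pi fun _ : Fin m => μ) = ∏ j, ∫⁻ y, f j y ∂μ := by
  induction m with
  | zero => simp
  | succ m ih =>
    have hmp := (measurePreserving_piFinSuccAbove (fun _ : Fin (m + 1) => μ) 0).symm
    rw [← hmp.lintegral_comp_emb (MeasurableEquiv.measurableEmbedding _)]
    simp only [Fin.prod_univ_succ, MeasurableEquiv.piFinSuccAbove_symm_apply,
      Fin.insertNthEquiv_zero, Fin.consEquiv_apply, Fin.cons_zero, Fin.cons_succ]
    rw [← ih (fun j => f j.succ) fun j => hf j.succ]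
    have hm : Measurable fun r : Fin m → α => ∏ j, f j.succ (r j) :=
      Finset.measurable_prod _ fun j _ => (hf j.succ).comp (measurable_pi_apply j)
    exact lintegral_prod_mul (hf 0).aemeasurable hm.aemeasurable

namespace RegModel

variable {𝒳 : Set ℝ} {μ : Measure ℝ} {Θ : Type*} [MeasurableSpace Θ] (M : RegModel 𝒳 μ Θ)

theorem measurable_lik {n m : ℕ} (x : Fin n → ℝ) :
    Measurable fun p : Θ × (Fin n → Fin m → ℝ) => M.lik x p.1 p.2 := by
  unfold lik
  refine Finset.measurable_prod _ fun j _ => Finset.measurable_prod _ fun i _ => ?_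
  have h : Measurable fun p : Θ × (Fin n → Fin m → ℝ) =>
      (p.1, x i, (fun l : Fin i => p.2 (Fin.castLE i.isLt.le l) j), p.2 i j) := by fun_prop
  exact (M.measurable_dens i).comp h

theorem measurable_lik_right {n m : ℕ} (x : Fin n → ℝ) (θ : Θ) :
    Measurable fun Y : Fin n → Fin m → ℝ => M.lik x θ Y :=
  (M.measurable_lik x).comp measurable_prodMk_left

theorem measurable_lik_left {n m : ℕ} (x : Fin n → ℝ) (Y : Fin n → Fin m → ℝ) :
    Measurable fun θ => M.lik x θ Y :=
  (M.measurable_lik x).comp measurable_prodMk_right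

theorem measurable_marg {n m : ℕ} (x : Fin n → ℝ) :
    Measurable fun Y : Fin n → Fin m → ℝ => M.marg x Y := by
  have := M.isProbabilityMeasure_prior
  exact (M.measurable_lik x).lintegral_prod_left'

theorem lik_succ {n m : ℕ} (x : Fin (n + 1) → ℝ) (θ : Θ) (Y : Fin (n + 1) → Fin m → ℝ) :
    M.lik x θ Y = M.lik (fun i => x i.castSucc) θ (fun i => Y i.castSucc) *
      ∏ j, M.dens n θ (x (Fin.last n)) (fun l => Y l.castSucc j) (Y (Fin.last n) j) := by
  unfold lik
  rw [← Finset.prod_mul_distrib]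
  refine Finset.prod_congr rfl fun j _ => ?_
  rw [Fin.prod_univ_castSucc]
  rfl

/-- The likelihood is a probability density. -/
theorem lintegral_lik [SigmaFinite μ] {n : ℕ} (m : ℕ) (x : Fin n → ℝ) (hx : ∀ i, x i ∈ 𝒳)
    (θ : Θ) : ∫⁻ Y, M.lik x θ Y ∂(Measure.pi fun _ => Measure.pi fun _ : Fin m => μ) = 1 := by
  induction n with
  | zero => simp [lik]
  | succ n ih =>
    -- The last row is integrated first: given the past, its replicates are independent, each with a
    -- density of total mass 1.
    have hmp := (measurePreserving_piFinSuccAbove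
      (fun _ : Fin (n + 1) => Measure.pi fun _ : Fin m => μ) (Fin.last n)).symm
    rw [← hmp.lintegral_comp_emb (MeasurableEquiv.measurableEmbedding _),
      lintegral_prod_symm' (fun z => M.lik x θ ((MeasurableEquiv.piFinSuccAbove _ (Fin.last n)).symm z))
        ((M.measurable_lik_right x θ).comp hmp.measurable),
      ← ih (fun i => x i.castSucc) fun i => hx _]
    refine lintegral_congr fun Y => ?_
    simp only [MeasurableEquiv.piFinSuccAbove_symm_apply, lik_succ, Fin.insertNthEquiv_last,
      Fin.snocEquiv_apply, Fin.snoc_castSucc, Fin.snoc_last]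
    have hd (past : Fin n → ℝ) : Measurable fun y => M.dens n θ (x (Fin.last n)) past y := by
      have h : Measurable fun y : ℝ => (θ, x (Fin.last n), past, y) := by fun_prop
      exact (M.measurable_dens n).comp h
    have hm : Measurable fun r : Fin m → ℝ =>
        ∏ j, M.dens n θ (x (Fin.last n)) (fun l => Y l j) (r j) :=
      Finset.measurable_prod _ fun j _ => (hd _).comp (measurable_pi_apply j)
    rw [lintegral_const_mul _ hm, lintegral_pi_prod_fin μ
      (fun j => M.dens n θ (x (Fin.last n)) fun l => Y l j) fun j => hd _]
    simp [M.lintegral_dens n θ _ (hx _)]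

theorem lintegral_marg [SigmaFinite μ] {n : ℕ} (m : ℕ) (x : Fin n → ℝ) (hx : ∀ i, x i ∈ 𝒳) :
    ∫⁻ Y, M.marg x Y ∂(Measure.pi fun _ => Measure.pi fun _ : Fin m => μ) = 1 := by
  have := M.isProbabilityMeasure_prior
  unfold marg
  rw [lintegral_lintegral_swap (f := fun Y θ => M.lik x θ Y)
    ((M.measurable_lik x).comp measurable_swap).aemeasurable]
  simp [M.lintegral_lik m x hx]

/-- The true density cancels against the denominator. Equality may fail where it is 0 or `⊤`, but
the upper bound is all that the tail estimate needs. -/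
theorem lintegral_lik_div_marg_le [SigmaFinite μ] {Θ₀ : Type*} [MeasurableSpace Θ₀]
    (M₀ : RegModel 𝒳 μ Θ₀) {n : ℕ} (m : ℕ) (x : Fin n → ℝ) (hx : ∀ i, x i ∈ 𝒳) (θ : Θ) :
    ∫⁻ Y, M.lik x θ Y / M₀.marg x Y ∂M₀.margLaw x m ≤ 1 := by
  have hm : Measurable fun Y : Fin n → Fin m → ℝ => M.lik x θ Y / M₀.marg x Y :=
    (M.measurable_lik_right x θ).div (M₀.measurable_marg x)
  rw [margLaw, lintegral_withDensity_eq_lintegral_mul _ (M₀.measurable_marg x) hm, ← M.lintegral_lik m x hx θ]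
  refine lintegral_mono fun Y => ?_
  simp only [Pi.mul_apply]
  exact ENNReal.mul_div_le

theorem ae_marg_ne_zero_ne_top [SigmaFinite μ] {n : ℕ} (m : ℕ) (x : Fin n → ℝ)
    (hx : ∀ i, x i ∈ 𝒳) : ∀ᵐ Y ∂M.margLaw x m, M.marg x Y ≠ 0 ∧ M.marg x Y ≠ ⊤ := by
  rw [margLaw, ae_withDensity_iff (M.measurable_marg x)]
  filter_upwards [ae_lt_top (M.measurable_marg x)
    (by rw [M.lintegral_marg m x hx]; exact ENNReal.one_ne_top)] with Y hY h0
  exact ⟨h0, hY.ne⟩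

theorem post_le_one {n m : ℕ} (x : Fin n → ℝ) (Y : Fin n → Fin m → ℝ) (A : Set Θ) :
    M.post x Y A ≤ 1 :=
  ENNReal.div_le_of_le_mul (by rw [one_mul]; exact setLIntegral_le_lintegral _ _)

end RegModel

/-! ### Cross-validation posteriors and concentration of the discrepancy -/

namespace InvModel

variable {𝒳 : Set ℝ} {μ : Measure ℝ} {Θ : Type*} [MeasurableSpace Θ] (M : InvModel 𝒳 μ Θ)
  {n m : ℕ}

theorem isProbabilityMeasure_cvPost {c : ℝ} {x : Fin n → ℝ} {Y : Fin n → Fin m → ℝ} {Θt : Set Θ}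
    {i : Fin n} (h0 : M.cvNorm c x Y Θt i ≠ 0) (ht : M.cvNorm c x Y Θt i ≠ ⊤) :
    IsProbabilityMeasure (M.cvPost c x Y Θt i) := by
  constructor
  rw [cvPost, Measure.smul_apply, withDensity_apply _ MeasurableSet.univ, Measure.restrict_univ,
    smul_eq_mul]
  exact ENNReal.inv_mul_cancel h0 ht

theorem ae_cvPost_mem (h𝒳 : MeasurableSet 𝒳) (c : ℝ) (x : Fin n → ℝ) (Y : Fin n → Fin m → ℝ)
    (Θt : Set Θ) (i : Fin n) : ∀ᵐ z ∂M.cvPost c x Y Θt i, z ∈ 𝒳 :=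
  Measure.ae_smul_measure ((withDensity_absolutelyContinuous _ _).ae_le (ae_restrict_mem h𝒳)) _

end InvModel

/-- An average of `n` bounded independent terms is concentrated around its mean. -/
theorem measure_le_abs_average_sub_integral_le {n : ℕ} (hn : 0 < n) (ν : Fin n → Measure ℝ)
    [∀ i, IsProbabilityMeasure (ν i)] (g : Fin n → ℝ → ℝ) (hg : ∀ i, Measurable (g i)) {C : ℝ}
    (hgC : ∀ i, ∀ᵐ z ∂ν i, g i z ∈ Icc 0 C) {η : ℝ} (hη : 0 < η) :
    Measure.pi ν {v | η ≤ |(1 / (n : ℝ)) * ∑ i, g i (v i) -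
      ∫ w, (1 / (n : ℝ)) * ∑ i, g i (w i) ∂Measure.pi ν|} ≤
      ENNReal.ofReal ((C / 2) ^ 2 / η ^ 2 / n) := by
  have hn' : (0 : ℝ) < n := by exact_mod_cast hn
  have hL (i : Fin n) : MemLp (g i) 2 (ν i) := by
    refine MemLp.of_bound (hg i).aestronglyMeasurable C ?_
    filter_upwards [hgC i] with z hz
    rw [Real.norm_of_nonneg hz.1]
    exact hz.2
  have hS : MemLp (∑ i, fun v : Fin n → ℝ => g i (v i)) 2 (Measure.pi ν) :=
    memLp_finsetSum' _ fun i _ => (hL i).comp_measurePreserving (measurePreserving_eval _ i)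
  have hS' : MemLp (fun v : Fin n → ℝ => (1 / (n : ℝ)) * ∑ i, g i (v i)) 2 (Measure.pi ν) := by
    convert! hS.const_mul (1 / (n : ℝ)) using 2
    simp
  refine (meas_ge_le_variance_div_sq hS' hη).trans (ENNReal.ofReal_le_ofReal ?_)
  have hV : Var[fun v : Fin n → ℝ => (1 / (n : ℝ)) * ∑ i, g i (v i); Measure.pi ν] =
      (1 / (n : ℝ)) ^ 2 * ∑ i, Var[g i; ν i] := by
    rw [variance_const_mul, ← variance_sum_pi hL]
    congr 2
    ext v
    simp
  -- Popoviciu's inequality bounds each variance by the squared half-range.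
  have hV2 : ∑ i, Var[g i; ν i] ≤ n * (C / 2) ^ 2 := by
    refine (Finset.sum_le_card_nsmul Finset.univ _ ((C / 2) ^ 2) fun i _ => ?_).trans (by simp)
    simpa using variance_le_sq_of_bounded (hgC i) (hg i).aemeasurable
  rw [hV]
  calc (1 / (n : ℝ)) ^ 2 * (∑ i, Var[g i; ν i]) / η ^ 2
      ≤ (1 / (n : ℝ)) ^ 2 * (n * (C / 2) ^ 2) / η ^ 2 := by gcongr
    _ = (C / 2) ^ 2 / η ^ 2 / n := by field_simp

namespace InvModel

variable {𝒳 : Set ℝ} {μ : Measure ℝ} {Θ : Type*} [MeasurableSpace Θ] (M : InvModel 𝒳 μ Θ)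

/-- The discrepancy of `X̃_n` is concentrated around its posterior mean. -/
theorem exists_xTildePost_le (h𝒳 : IsCompact 𝒳) (D : Disc) (c : ℝ) {c' : ℝ} (hc' : 0 < c') :
    ∃ C : ℝ, ∀ n > 0, ∀ m (x : Fin n → ℝ) (Y : Fin n → Fin m → ℝ) (Θt : Set Θ),
      (∀ i, M.cvNorm c x Y Θt i ≠ 0 ∧ M.cvNorm c x Y Θt i ≠ ⊤) → ∀ η : ℝ, 0 < η →
      M.xTildePost c x Y Θt {v | η ≤ |M.T D c c' x Y Θt v -
        ∫ w, M.T D c c' x Y Θt w ∂M.xTildePost c x Y Θt|} ≤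
      ENNReal.ofReal (C / η ^ 2 / n) := by
  -- Deviations are at most `2 * B` and denominators are bounded below through `c'`, so the constant
  -- does not depend on `n`, `m` or the data.
  obtain ⟨B, hB, hB𝒳⟩ := h𝒳.isBounded.exists_pos_norm_le
  have hdist {n m : ℕ} {x : Fin n → ℝ} {Y : Fin n → Fin m → ℝ} {Θt : Set Θ}
      (h : ∀ i, M.cvNorm c x Y Θt i ≠ 0 ∧ M.cvNorm c x Y Θt i ≠ ⊤) (i : Fin n) :
      ∀ᵐ z ∂M.cvPost c x Y Θt i, |z - ∫ z, z ∂M.cvPost c x Y Θt i| ≤ 2 * B := by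
    have := M.isProbabilityMeasure_cvPost (h i).1 (h i).2
    have hmem := M.ae_cvPost_mem h𝒳.measurableSet c x Y Θt i
    have hE : ‖∫ z, z ∂M.cvPost c x Y Θt i‖ ≤ B := by
      refine (norm_integral_le_of_norm_le_const (hmem.mono fun z hz => hB𝒳 z hz)).trans ?_
      simp
    filter_upwards [hmem] with z hz
    calc |z - ∫ z, z ∂M.cvPost c x Y Θt i| ≤ |z| + |∫ z, z ∂M.cvPost c x Y Θt i| := abs_sub _ _
      _ ≤ B + B := add_le_add (hB𝒳 z hz) hE
      _ = 2 * B := by ring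
  have hV {n m : ℕ} (x : Fin n → ℝ) (Y : Fin n → Fin m → ℝ) (Θt : Set Θ) (i : Fin n) :
      c' ≤ Var[id; M.cvPost c x Y Θt i] + c' :=
    le_add_of_nonneg_left (variance_nonneg _ _)
  cases D with
  | abs =>
    refine ⟨(2 * B / √c' / 2) ^ 2, fun n hn m x Y Θt h η hη => ?_⟩
    have (i : Fin n) := M.isProbabilityMeasure_cvPost (h i).1 (h i).2
    refine measure_le_abs_average_sub_integral_le hn (fun i => M.cvPost c x Y Θt i)
      (fun i z => |z - ∫ z, z ∂M.cvPost c x Y Θt i| / √(Var[id; M.cvPost c x Y Θt i] + c'))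
      (fun i => by fun_prop) (fun i => ?_) hη
    filter_upwards [hdist h i] with z hz
    have := Real.sqrt_le_sqrt (hV x Y Θt i)
    have := Real.sqrt_pos.2 hc'
    exact ⟨by positivity, by gcongr⟩
  | sq =>
    refine ⟨((2 * B) ^ 2 / c' / 2) ^ 2, fun n hn m x Y Θt h η hη => ?_⟩
    have (i : Fin n) := M.isProbabilityMeasure_cvPost (h i).1 (h i).2
    refine measure_le_abs_average_sub_integral_le hn (fun i => M.cvPost c x Y Θt i)
      (fun i z => (z - ∫ z, z ∂M.cvPost c x Y Θt i) ^ 2 / (Var[id; M.cvPost c x Y Θt i] + c'))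
      (fun i => by fun_prop) (fun i => ?_) hη
    filter_upwards [hdist h i] with z hz
    have := hV x Y Θt i
    have := hc'.trans_le this
    rw [← sq_abs (z - _)]
    exact ⟨by positivity, by gcongr⟩

theorem isProbabilityMeasure_xTildePost {n m : ℕ} {c : ℝ} {x : Fin n → ℝ} {Y : Fin n → Fin m → ℝ}
    {Θt : Set Θ} (h : ∀ i, M.cvNorm c x Y Θt i ≠ 0 ∧ M.cvNorm c x Y Θt i ≠ ⊤) :
    IsProbabilityMeasure (M.xTildePost c x Y Θt) := by
  have (i : Fin n) := M.isProbabilityMeasure_cvPost (h i).1 (h i).2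
  exact Measure.pi.instIsProbabilityMeasure _

end InvModel

/-- If `X` is within `ε / 4` of `E` except on a set whose measure is less than that of `X ∈ [l, u]`,
then `X - b` lies in `[l - a - ε, u - a + ε]` outside of that set, when `b` is close to `a`. -/
theorem measure_sub_notMem_Icc_le {V : Type*} [MeasurableSpace V] (ν : Measure V) (X : V → ℝ)
    {E l u a b ε : ℝ} (hb : |b - a| < ε / 2)
    (h : ν {v | ε / 4 ≤ |X v - E|} < ν {v | X v ∈ Icc l u}) :
    ν {v | X v - b ∉ Icc (l - a - ε) (u - a + ε)} ≤ ν {v | ε / 4 ≤ |X v - E|} := by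
  -- Through `v₀` the interval comes within `ε / 4` of `E`. Any other good `v` has `X v` within `ε /
  -- 2` of `X v₀`, and `b` costs another `ε / 2`.
  obtain ⟨v₀, hv₀, hv₀'⟩ : ∃ v ∈ {v | X v ∈ Icc l u}, v ∉ {v | ε / 4 ≤ |X v - E|} := by
    by_contra! hcon
    exact absurd (measure_mono hcon) (not_le.2 h)
  refine measure_mono fun v hv => ?_
  by_contra hv'
  simp only [mem_ofPred_eq, not_le, mem_Icc] at *
  rw [abs_lt] at *
  exact hv ⟨by linarith, by linarith⟩

/-! ### Vanishing posterior odds -/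

namespace ShaliziConditions

variable {Ω Θ Θ' : Type*} [mΩ : MeasurableSpace Ω] [MeasurableSpace Θ] [MeasurableSpace Θ']
  {P : Measure Ω} {ℱ : ℕ → MeasurableSpace Ω} {prior : Measure Θ} {prior' : Measure Θ'}
  {R : ℕ → Θ → Ω → ℝ≥0∞} {R' : ℕ → Θ' → Ω → ℝ≥0∞} {kl : ℕ → Θ → ℝ≥0∞} {kl' : ℕ → Θ' → ℝ≥0∞}

theorem ae_eventually_lintegral_ne_top [IsProbabilityMeasure P] [IsProbabilityMeasure prior]
    (hℱ : ∀ n, ℱ n ≤ mΩ) (hS : ShaliziConditions P ℱ prior R kl)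
    (hR : ∀ n θ, ∫⁻ ω, R n θ ω ∂P ≤ 1) :
    ∀ᵐ ω ∂P, ∀ᶠ n : ℕ in atTop, ∫⁻ θ, R n θ ω ∂prior ≠ ⊤ := by
  obtain ⟨γ, hγ, -, h⟩ := hS.exists_ae_eventually_setLIntegral_le hℱ hR
  -- Since `h ≥ 0`, a negative rate is always admissible, and finiteness needs no more.
  filter_upwards [h univ MeasurableSet.univ (-1) (by linarith)
    (lt_of_lt_of_le (by norm_num) (EReal.coe_ennreal_nonneg _))] with ω hω
  filter_upwards [hω] with n hn
  rw [setLIntegral_univ] at hn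
  exact ne_top_of_le_ne_top (ENNReal.mul_ne_top (by simp) ENNReal.ofReal_ne_top) hn

theorem ae_eventually_lintegral_ne_zero [IsProbabilityMeasure prior]
    (hS : ShaliziConditions P ℱ prior R kl) (hfin : essInfOn prior (klRate kl) univ ≠ ⊤) :
    ∀ᵐ ω ∂P, ∀ᶠ n : ℕ in atTop, ∫⁻ θ, R n θ ω ∂prior ≠ 0 := by
  obtain ⟨s, -, hs, -⟩ := ENNReal.lt_iff_exists_real_btwn.1 hfin.lt_top
  filter_upwards [hS.eventually_exp_le_lintegral hs] with ω hω
  filter_upwards [hω] with n hn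
  exact ((ENNReal.ofReal_pos.2 (Real.exp_pos _)).trans_le hn).ne'

/-- The posterior odds of a set with a larger divergence rate vanish. -/
theorem ae_tendsto_lintegral_div [IsProbabilityMeasure P] [IsProbabilityMeasure prior]
    [IsProbabilityMeasure prior'] (hℱ : ∀ n, ℱ n ≤ mΩ) (hS : ShaliziConditions P ℱ prior R kl)
    (hS' : ShaliziConditions P ℱ prior' R' kl') (hR' : ∀ n θ, ∫⁻ ω, R' n θ ω ∂P ≤ 1)
    {A : Set Θ'} (hA : MeasurableSet A)
    (hle : essInfOn prior (klRate kl) univ ≤ essInfOn prior' (klRate kl') univ)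
    (hlt : essInfOn prior (klRate kl) univ < essInfOn prior' (klRate kl') A) :
    ∀ᵐ ω ∂P, Tendsto (fun n : ℕ => (∫⁻ θ in A, R' n θ ω ∂prior') / ∫⁻ θ, R n θ ω ∂prior) atTop
      (𝓝 0) := by
  obtain ⟨γ, -, hγ, h⟩ := hS'.exists_ae_eventually_setLIntegral_le hℱ hR'
  -- Here `γ` belongs to the sieves of `prior'`; `hle` is what places it above the rate of `prior`.
  -- This leaves room for `s₁ < s₂` between that rate and both `γ` and `h(A)`.
  have hγ' : essInfOn prior (klRate kl) univ < ENNReal.ofReal γ :=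
    hle.trans_lt (lt_of_le_of_lt (le_mul_of_one_le_left' (by norm_num)) hγ)
  obtain ⟨s₂, hs₂0, h2, h2'⟩ := ENNReal.lt_iff_exists_real_btwn.1 (lt_min hγ' hlt)
  obtain ⟨s₁, hs₁0, h1, h12⟩ := ENNReal.lt_iff_exists_real_btwn.1 h2
  have h12' : s₁ < s₂ := (ENNReal.ofReal_lt_ofReal_iff'.1 h12).1
  have hs₂ : s₂ < γ := (ENNReal.ofReal_lt_ofReal_iff'.1 (h2'.trans_le (min_le_left _ _))).1
  have hs₂A : (s₂ : EReal) < essInfOn prior' (klRate kl') A := by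
    have := EReal.coe_ennreal_lt_coe_ennreal_iff.2 (h2'.trans_le (min_le_right _ _))
    rwa [EReal.coe_ennreal_ofReal, max_eq_left hs₂0] at this
  have hlim : Tendsto (fun n : ℕ => 2 * ENNReal.ofReal (Real.exp (-(n * (s₂ - s₁))))) atTop
      (𝓝 0) := by
    have h0 : Tendsto (fun n : ℕ => ENNReal.ofReal (Real.exp (-(n * (s₂ - s₁))))) atTop (𝓝 0) := by
      rw [← ENNReal.ofReal_zero]
      refine ENNReal.tendsto_ofReal (Real.tendsto_exp_atBot.comp ?_)
      exact tendsto_neg_atTop_atBot.comp (tendsto_natCast_atTop_atTop.atTop_mul_const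
        (by linarith))
    simpa using ENNReal.Tendsto.const_mul h0 (Or.inr (ENNReal.ofNat_ne_top (n := 2)))
  filter_upwards [hS.eventually_exp_le_lintegral h1, h A hA s₂ hs₂ hs₂A] with ω hω1 hω2
  refine tendsto_of_tendsto_of_tendsto_of_le_of_le' tendsto_const_nhds hlim
    (Eventually.of_forall fun _ => zero_le) ?_
  filter_upwards [hω1, hω2] with n hn1 hn2
  refine (ENNReal.div_le_div hn2 hn1).trans (le_of_eq ?_)
  rw [mul_div_assoc, ← ENNReal.ofReal_div_of_pos (Real.exp_pos _), ← Real.exp_sub]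
  ring_nf

end ShaliziConditions

theorem ShaliziConditions.essInfOn_univ_ne_top {Ω Θ : Type*} [MeasurableSpace Ω]
    [MeasurableSpace Θ] {P : Measure Ω} {ℱ : ℕ → MeasurableSpace Ω} {prior : Measure Θ}
    {R : ℕ → Θ → Ω → ℝ≥0∞} {kl : ℕ → Θ → ℝ≥0∞} (hS : ShaliziConditions P ℱ prior R kl) :
    essInfOn prior (klRate kl) univ ≠ ⊤ := by
  obtain ⟨G, -, -, ⟨b, γ, -, -, h, -⟩, -⟩ := hS.s567
  intro h'
  simp [h'] at h

/-- Replacing the total by the single weight `w n kt` only enlarges each other share. Finite,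
nonzero totals make the shares sum to 1, which leaves 1 for `kt`. -/
theorem tendsto_div_sum_of_tendsto_div {K : ℕ} {w : ℕ → Fin K → ℝ≥0∞} {kt : Fin K}
    (hfin : ∀ k, ∀ᶠ n in atTop, w n k ≠ ⊤) (hpos : ∀ᶠ n in atTop, w n kt ≠ 0)
    (h : ∀ k ≠ kt, Tendsto (fun n => w n k / w n kt) atTop (𝓝 0)) :
    Tendsto (fun n => w n kt / ∑ l, w n l) atTop (𝓝 1) ∧
      Tendsto (fun n => ∑ k ∈ Finset.univ.erase kt, w n k / ∑ l, w n l) atTop (𝓝 0) := by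
  have h2 : Tendsto (fun n => ∑ k ∈ Finset.univ.erase kt, w n k / ∑ l, w n l) atTop (𝓝 0) := by
    rw [← Finset.sum_const_zero (s := Finset.univ.erase kt)]
    refine tendsto_finsetSum _ fun k hk => ?_
    refine tendsto_of_tendsto_of_tendsto_of_le_of_le tendsto_const_nhds
      (h k (Finset.ne_of_mem_erase hk)) (fun _ => zero_le) fun n => ?_
    exact ENNReal.div_le_div_left (Finset.single_le_sum (fun _ _ => zero_le)
      (Finset.mem_univ kt)) _
  refine ⟨?_, h2⟩
  have h3 := ENNReal.Tendsto.sub (tendsto_const_nhds (x := (1 : ℝ≥0∞))) h2 (Or.inl (by simp))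
  rw [tsub_zero] at h3
  refine h3.congr' ?_
  filter_upwards [eventually_all.2 hfin, hpos, h2.eventually_lt_const zero_lt_one]
    with n hn hn0 hlt
  have hs : ∑ k, w n k / ∑ l, w n l = 1 := by
    simp_rw [div_eq_mul_inv]
    rw [← Finset.sum_mul]
    refine ENNReal.mul_inv_cancel ?_ (ENNReal.sum_ne_top.2 fun k _ => hn k)
    exact fun h0 => hn0 (Finset.sum_eq_zero_iff.1 h0 kt (Finset.mem_univ _))
  rw [← Finset.add_sum_erase _ _ (Finset.mem_univ kt)] at hs
  rw [← hs]
  exact ENNReal.add_sub_cancel_right (ne_top_of_lt hlt)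

/-! ### Transfer to the marginal likelihoods of regression models -/

section Asymptotics

variable {Ω : Type*} [MeasurableSpace Ω] {P : Measure Ω} {𝒳 : Set ℝ}
  {μ : Measure ℝ} {Θ₀ Θ Θ' : Type*} [MeasurableSpace Θ₀] [MeasurableSpace Θ]
  [MeasurableSpace Θ'] {M₀ : RegModel 𝒳 μ Θ₀} {M : RegModel 𝒳 μ Θ} {M' : RegModel 𝒳 μ Θ'}
  {x : ℕ → ℝ} {y : ℕ → ℕ → Ω → ℝ} {m : ℕ}

theorem measurable_responses (hy : ∀ i j, Measurable (y i j)) (n m : ℕ) :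
    Measurable (responses y n m) :=
  measurable_pi_iff.2 fun i => measurable_pi_iff.2 fun j => hy i j

theorem lintegral_likelihoodRatio_le [SigmaFinite μ] (hx : ∀ i, x i ∈ 𝒳) (hy : ∀ i j, Measurable (y i j))
    (hlaw : ∀ n m, P.map (responses y n m) = M₀.margLaw (covariates x n) m) (n : ℕ) (θ : Θ) :
    ∫⁻ ω, M.lik (covariates x n) θ (responses y n m ω) /
      M₀.marg (covariates x n) (responses y n m ω) ∂P ≤ 1 := by
  refine le_trans (le_of_eq ?_) (M.lintegral_lik_div_marg_le M₀ m (covariates x n)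
    (fun i => hx i) θ)
  rw [← hlaw n m]
  have hm : Measurable fun Y : Fin n → Fin m → ℝ =>
      M.lik (covariates x n) θ Y / M₀.marg (covariates x n) Y :=
    (M.measurable_lik_right _ θ).div (M₀.measurable_marg _)
  exact (lintegral_map hm (measurable_responses hy n m)).symm

theorem ae_marg_responses_ne_zero_ne_top [SigmaFinite μ] (hx : ∀ i, x i ∈ 𝒳) (hy : ∀ i j, Measurable (y i j))
    (hlaw : ∀ n m, P.map (responses y n m) = M₀.margLaw (covariates x n) m) :
    ∀ᵐ ω ∂P, ∀ n, M₀.marg (covariates x n) (responses y n m ω) ≠ 0 ∧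
      M₀.marg (covariates x n) (responses y n m ω) ≠ ⊤ := by
  refine ae_all_iff.2 fun n => ?_
  have h := M₀.ae_marg_ne_zero_ne_top m (covariates x n) fun i => hx i
  rw [← hlaw n m] at h
  exact ae_of_ae_map (measurable_responses hy n m).aemeasurable h

theorem RegModel.setLIntegral_lik_div {n : ℕ} (M : RegModel 𝒳 μ Θ) (x : Fin n → ℝ)
    (Y : Fin n → Fin m → ℝ) (A : Set Θ) (f : ℝ≥0∞) :
    ∫⁻ θ in A, M.lik x θ Y / f ∂M.prior = (∫⁻ θ in A, M.lik x θ Y ∂M.prior) / f := by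
  simp_rw [div_eq_mul_inv]
  exact lintegral_mul_const _ (M.measurable_lik_left x Y)

theorem RegModel.lintegral_lik_div {n : ℕ} (M : RegModel 𝒳 μ Θ) (x : Fin n → ℝ)
    (Y : Fin n → Fin m → ℝ) (f : ℝ≥0∞) :
    ∫⁻ θ, M.lik x θ Y / f ∂M.prior = M.marg x Y / f := by
  simpa [RegModel.marg] using M.setLIntegral_lik_div x Y univ f

theorem SatisfiesShalizi.ae_eventually_marg_ne_top [IsProbabilityMeasure P] [SigmaFinite μ]
    (hx : ∀ i, x i ∈ 𝒳) (hy : ∀ i j, Measurable (y i j))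
    (hlaw : ∀ n m, P.map (responses y n m) = M₀.margLaw (covariates x n) m)
    (hS : SatisfiesShalizi P M₀ M x y m) :
    ∀ᵐ ω ∂P, ∀ᶠ n in atTop, M.marg (covariates x n) (responses y n m ω) ≠ ⊤ := by
  have := M.isProbabilityMeasure_prior
  filter_upwards [ShaliziConditions.ae_eventually_lintegral_ne_top
      (fun n => (measurable_responses hy n m).comap_le) hS
      (lintegral_likelihoodRatio_le hx hy hlaw),
    ae_marg_responses_ne_zero_ne_top (m := m) hx hy hlaw] with ω hω hω0
  filter_upwards [hω] with n hn h
  rw [RegModel.lintegral_lik_div, h] at hn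
  exact hn (ENNReal.top_div_of_ne_top (hω0 n).2)

theorem SatisfiesShalizi.ae_eventually_marg_ne_zero (hS : SatisfiesShalizi P M₀ M x y m) :
    ∀ᵐ ω ∂P, ∀ᶠ n in atTop, M.marg (covariates x n) (responses y n m ω) ≠ 0 := by
  have := M.isProbabilityMeasure_prior
  filter_upwards [ShaliziConditions.ae_eventually_lintegral_ne_zero hS
    (ShaliziConditions.essInfOn_univ_ne_top hS)] with ω hω
  filter_upwards [hω] with n hn h
  rw [RegModel.lintegral_lik_div, h, ENNReal.zero_div] at hn
  exact hn rfl

theorem SatisfiesShalizi.ae_tendsto_div_marg [IsProbabilityMeasure P] [SigmaFinite μ]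
    (hx : ∀ i, x i ∈ 𝒳) (hy : ∀ i j, Measurable (y i j))
    (hlaw : ∀ n m, P.map (responses y n m) = M₀.margLaw (covariates x n) m)
    (hS : SatisfiesShalizi P M₀ M x y m) (hS' : SatisfiesShalizi P M₀ M' x y m) {A : Set Θ'}
    (hA : MeasurableSet A) (hle : minKLRate M₀ M x m univ ≤ minKLRate M₀ M' x m univ)
    (hlt : minKLRate M₀ M x m univ < minKLRate M₀ M' x m A) :
    ∀ᵐ ω ∂P, Tendsto (fun n => (∫⁻ θ in A, M'.lik (covariates x n) θ (responses y n m ω) ∂M'.prior) /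
      M.marg (covariates x n) (responses y n m ω)) atTop (𝓝 0) := by
  have := M.isProbabilityMeasure_prior
  have := M'.isProbabilityMeasure_prior
  filter_upwards [ShaliziConditions.ae_tendsto_lintegral_div
      (fun n => (measurable_responses hy n m).comap_le) hS hS'
      (lintegral_likelihoodRatio_le hx hy hlaw) hA hle hlt,
    ae_marg_responses_ne_zero_ne_top (m := m) hx hy hlaw] with ω hω hω0
  refine hω.congr fun n => ?_
  -- The true marginal density is common to both integrals and cancels, being almost surely neither
  -- 0 nor `⊤`.
  rw [RegModel.setLIntegral_lik_div, RegModel.lintegral_lik_div, div_eq_mul_inv _ (M₀.marg _ _),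
    div_eq_mul_inv _ (M₀.marg _ _), ENNReal.mul_div_mul_right _ _
      (ENNReal.inv_ne_zero.2 (hω0 n).2) (ENNReal.inv_ne_top.2 (hω0 n).1)]

end Asymptotics

/-! ### Posterior model probabilities and bounds for the alternatives -/

section Testing

variable {𝒳 : Set ℝ} {μ : Measure ℝ} {K : ℕ} {Θ : Fin K → Type*} [∀ k, MeasurableSpace (Θ k)]
  {n m : ℕ}

theorem postModel_eq (M : ∀ k, InvModel 𝒳 μ (Θ k)) (ρ : Measure (Fin K → ℝ))
    (x : Fin n → ℝ) (Y : Fin n → Fin m → ℝ) (k : Fin K) :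
    postModel M ρ x Y k = ((∫⁻ p, ENNReal.ofReal (p k) ∂ρ) * (M k).marg x Y) /
      ∑ l, (∫⁻ p, ENNReal.ofReal (p l) ∂ρ) * (M l).marg x Y := by
  have h (l : Fin K) : ∫⁻ p, ENNReal.ofReal (p l) * (M l).marg x Y ∂ρ =
      (∫⁻ p, ENNReal.ofReal (p l) ∂ρ) * (M l).marg x Y :=
    lintegral_mul_const _ (measurable_pi_apply l).ennreal_ofReal
  simp only [postModel, h]

theorem postModel_le_one (M : ∀ k, InvModel 𝒳 μ (Θ k)) (ρ : Measure (Fin K → ℝ))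
    (x : Fin n → ℝ) (Y : Fin n → Fin m → ℝ) (k : Fin K) : postModel M ρ x Y k ≤ 1 :=
  ENNReal.div_le_of_le_mul (by
    rw [one_mul]
    exact Finset.single_le_sum (f := fun l => ∫⁻ p, ENNReal.ofReal (p l) * (M l).marg x Y ∂ρ)
      (fun _ _ => zero_le) (Finset.mem_univ k))

theorem tendsto_postModel (M : ∀ k, InvModel 𝒳 μ (Θ k)) (ρ : Measure (Fin K → ℝ))
    (hρfin : ∀ k, ∫⁻ p, ENNReal.ofReal (p k) ∂ρ ≠ ⊤) {kt : Fin K}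
    (hρkt : 0 < ∫⁻ p, ENNReal.ofReal (p kt) ∂ρ) (x : ∀ n, Fin n → ℝ)
    (Y : ∀ n, Fin n → Fin m → ℝ) (hfin : ∀ k, ∀ᶠ n in atTop, (M k).marg (x n) (Y n) ≠ ⊤)
    (hpos : ∀ᶠ n in atTop, (M kt).marg (x n) (Y n) ≠ 0)
    (h : ∀ k ≠ kt, Tendsto (fun n => (M k).marg (x n) (Y n) / (M kt).marg (x n) (Y n)) atTop
      (𝓝 0)) :
    Tendsto (fun n => postModel M ρ (x n) (Y n) kt) atTop (𝓝 1) ∧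
      Tendsto (fun n => ∑ k ∈ Finset.univ.erase kt, postModel M ρ (x n) (Y n) k) atTop (𝓝 0) := by
  simp only [postModel_eq]
  refine tendsto_div_sum_of_tendsto_div (w := fun n k =>
    (∫⁻ p, ENNReal.ofReal (p k) ∂ρ) * (M k).marg (x n) (Y n))
    (fun k => (hfin k).mono fun n hn => ENNReal.mul_ne_top (hρfin k) hn)
    (hpos.mono fun n hn => mul_ne_zero hρkt.ne' hn) fun k hk => ?_
  have h1 := ENNReal.Tendsto.const_mul (h k hk)
    (Or.inr (ENNReal.div_ne_top (hρfin k) hρkt.ne'))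
  rw [mul_zero] at h1
  refine h1.congr fun n => ?_
  rw [div_eq_mul_inv, div_eq_mul_inv, div_eq_mul_inv,
    ENNReal.mul_inv (Or.inl hρkt.ne') (Or.inl (hρfin kt))]
  ring

theorem decisionRule_bestDecision_eq_one {v : Fin K → ℝ} {β : ℝ} {kt : Fin K} (h : v kt ≤ β)
    (h' : ∀ k ≠ kt, β < v k) : decisionRule v β (bestDecision kt) = 1 := by
  rw [decisionRule, if_pos]
  ext k
  by_cases hk : k = kt
  · simp [bestDecision, optimalDecision, hk, h]
  · simp [bestDecision, optimalDecision, hk, h' k hk]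

/-- The event `ζ = l` is part of `ζ ≠ k`. Proper cross-validation posteriors keep the total finite,
so that `toReal` is monotone. -/
theorem postModel_le_postAlt (M : ∀ k, InvModel 𝒳 μ (Θ k)) (ρ : Measure (Fin K → ℝ))
    (Θt : ∀ k, Set (Θ k)) (D : Fin K → Disc) (c c' : ℝ) (lo up : Fin K → ℝ) (x : Fin n → ℝ)
    (Y : Fin n → Fin m → ℝ) {k l : Fin K} (hkl : l ≠ k)
    (h : ∀ i, (M k).cvNorm c x Y (Θt k) i ≠ 0 ∧ (M k).cvNorm c x Y (Θt k) i ≠ ⊤) :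
    (postModel M ρ x Y l).toReal ≤ postAlt M ρ Θt D c c' lo up x Y k := by
  have := (M k).isProbabilityMeasure_xTildePost h
  have hne (j : Fin K) : postModel M ρ x Y j ≠ ⊤ :=
    ne_top_of_le_ne_top ENNReal.one_ne_top (postModel_le_one M ρ x Y j)
  have hpost (A : Set (Θ k)) : (M k).post x Y A ≠ ⊤ :=
    ne_top_of_le_ne_top ENNReal.one_ne_top ((M k).post_le_one x Y A)
  refine ENNReal.toReal_mono (ENNReal.add_ne_top.2 ⟨ENNReal.add_ne_top.2
    ⟨ENNReal.sum_ne_top.2 fun j _ => hne j, ENNReal.mul_ne_top (hne k) (hpost _)⟩,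
    ENNReal.mul_ne_top (ENNReal.mul_ne_top (hne k) (hpost _)) (measure_ne_top _ _)⟩) ?_
  rw [add_assoc]
  refine le_add_right (Finset.single_le_sum (f := fun j => postModel M ρ x Y j)
    (fun _ _ => zero_le) (Finset.mem_erase.2 ⟨hkl, Finset.mem_univ l⟩))

/-- Dropping the posterior factors, all at most 1, leaves three terms that can be shown to vanish
separately. -/
theorem postAlt_lt (M : ∀ k, InvModel 𝒳 μ (Θ k)) (ρ : Measure (Fin K → ℝ))
    (Θt : ∀ k, Set (Θ k)) (D : Fin K → Disc) (c c' : ℝ) (lo up : Fin K → ℝ) (x : Fin n → ℝ)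
    (Y : Fin n → Fin m → ℝ) {k : Fin K} {b : ℝ}
    (h : (∑ l ∈ Finset.univ.erase k, postModel M ρ x Y l) + (M k).post x Y (Θt k)ᶜ +
      (M k).xTildePost c x Y (Θt k) {v | (M k).T (D k) c c' x Y (Θt k) v -
        (M k).T (D k) c c' x Y (Θt k) x ∉ Icc (lo k) (up k)} < ENNReal.ofReal b) :
    postAlt M ρ Θt D c c' lo up x Y k < b := by
  refine (ENNReal.toReal_lt_of_lt_ofReal (lt_of_le_of_lt ?_ h))
  have h1 := postModel_le_one M ρ x Y k
  gcongr
  · exact mul_le_of_le_one_left' h1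
  · exact mul_le_of_le_one_left' (mul_le_one' h1 ((M k).post_le_one x Y _))

end Testing

/-! ### Asymptotic optimality -/

theorem mainTheorem3
    {Ω : Type*} [MeasurableSpace Ω] (P : Measure Ω) [IsProbabilityMeasure P]
    -- covariate space, covariates, and common dominating measure for the responses
    (𝒳 : Set ℝ) (h𝒳 : IsCompact 𝒳) (h𝒳pos : 0 < volume 𝒳)
    (x : ℕ → ℝ) (hx : ∀ i, x i ∈ 𝒳)
    (μ : Measure ℝ) [SigmaFinite μ]
    -- the true model generates the responses
    {Θ₀ : Type*} [MeasurableSpace Θ₀] (M₀ : RegModel 𝒳 μ Θ₀)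
    (y : ℕ → ℕ → Ω → ℝ) (hy : ∀ i j, Measurable (y i j))
    (hlaw : ∀ n m, P.map (responses y n m) = M₀.margLaw (covariates x n) m)
    -- the competing models, and the prior on the vector of model probabilities
    {K : ℕ} (hK : 1 < K) {Θ : Fin K → Type*} [∀ k, MeasurableSpace (Θ k)]
    (M : ∀ k, InvModel 𝒳 μ (Θ k))
    (ρ : Measure (Fin K → ℝ)) [IsProbabilityMeasure ρ] (hρ : ∀ᵐ p ∂ρ, p ∈ stdSimplex ℝ (Fin K))
    (hS : ∀ k, ∀ m ≥ 1, SatisfiesShalizi P M₀ (M k).toRegModel x y m)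
    -- the best model has the least divergence rate from the truth
    (kt : Fin K) (hkt : ∀ k, k ≠ kt → ∀ m ≥ 1,
      minKLRate M₀ (M kt).toRegModel x m univ < minKLRate M₀ (M k).toRegModel x m univ)
    (hρkt : 0 < ∫⁻ p, ENNReal.ofReal (p kt) ∂ρ)
    -- the subsets of the parameter spaces which hold the minimizers of the divergence
    (Θt : ∀ k, Set (Θ k)) (hΘt : ∀ k, MeasurableSet (Θt k))
    (hΘtmin : ∀ k, ∀ m ≥ 1,
      minKLRate M₀ (M k).toRegModel x m univ < minKLRate M₀ (M k).toRegModel x m (Θt k)ᶜ)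
    -- the discrepancy measures, with well-defined cross-validation posteriors
    (D : Fin K → Disc) (c c' : ℝ) (hc : 1 ≤ c) (hc' : 0 < c')
    (hcv : ∀ᵐ ω ∂P, ∀ k, ∀ n > 1, ∀ m > 1, ∀ i : Fin n,
      (M k).cvNorm c (covariates x n) (responses y n m ω) (Θt k) i ≠ 0 ∧
      (M k).cvNorm c (covariates x n) (responses y n m ω) (Θt k) i ≠ ⊤)
    -- the constants `a k` are the limits of the discrepancies of the observed covariates
    (a : Fin K → ℝ)
    (ha : ∀ k, ∀ᵐ ω ∂P, IterLim (fun n m =>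
      (M k).T (D k) c c' (covariates x n) (responses y n m ω) (Θt k) (covariates x n)) (a k))
    -- `[ℓ, u]` is a credible interval of level `1 - α` for the discrepancy
    (α : ℝ) (hα : α ∈ Ioo (0 : ℝ) 1)
    (ℓ u : ℕ → ℕ → Ω → Fin K → ℝ)
    (hcred : ∀ᵐ ω ∂P, ∀ k, ∀ n > 1, ∀ m > 1,
      ENNReal.ofReal (1 - α) ≤
        (M k).xTildePost c (covariates x n) (responses y n m ω) (Θt k)
          {v | (M k).T (D k) c c' (covariates x n) (responses y n m ω) (Θt k) v ∈
            Icc (ℓ n m ω k) (u n m ω k)})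
    (ε : ℝ) (hε : 0 < ε)
    -- the penalty `lam / (1 + lam)` is bounded away from `0` and `1` in the limit
    (lam : ℕ → ℕ → ℝ) (hlam : ∀ n m, 0 < lam n m)
    (hβinf : 0 < liminf (fun p : ℕ × ℕ => lam p.1 p.2 / (1 + lam p.1 p.2)) (atTop ×ˢ atTop))
    (hβsup : limsup (fun p : ℕ × ℕ => lam p.1 p.2 / (1 + lam p.1 p.2)) (atTop ×ˢ atTop) < 1) :
    AsymptoticallyOptimal P
      (fun n m ω => decisionRule
        (postAlt M ρ Θt D c c'
          (fun k => ℓ n m ω k - a k - ε) (fun k => u n m ω k - a k + ε)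
          (covariates x n) (responses y n m ω))
        (lam n m / (1 + lam n m)))
      kt := by
  classical
  have hρle (k : Fin K) : ∫⁻ p, ENNReal.ofReal (p k) ∂ρ ≤ 1 := by
    calc ∫⁻ p, ENNReal.ofReal (p k) ∂ρ ≤ ∫⁻ _, 1 ∂ρ := by
          refine lintegral_mono_ae ?_
          filter_upwards [hρ] with p hp
          rw [← ENNReal.ofReal_one]
          exact ENNReal.ofReal_le_ofReal
            (hp.2 ▸ Finset.single_le_sum (fun i _ => hp.1 i) (Finset.mem_univ k))
      _ = 1 := by simp
  have hle (k : Fin K) (m : ℕ) (hm : m ≥ 1) : minKLRate M₀ (M kt).toRegModel x m univ ≤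
      minKLRate M₀ (M k).toRegModel x m univ := by
    by_cases hk : k = kt
    · rw [hk]
    · exact (hkt k hk m hm).le
  have hmodel : ∀ᵐ ω ∂P, ∀ m ≥ 1,
      Tendsto (fun n => postModel M ρ (covariates x n) (responses y n m ω) kt) atTop (𝓝 1) ∧
      Tendsto (fun n => ∑ k ∈ Finset.univ.erase kt,
        postModel M ρ (covariates x n) (responses y n m ω) k) atTop (𝓝 0) := by
    refine ae_all_iff.2 fun m => eventually_imp_distrib_left.2 fun hm => ?_
    have hratio : ∀ᵐ ω ∂P, ∀ k, k ≠ kt → Tendsto (fun n =>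
        (M k).marg (covariates x n) (responses y n m ω) /
          (M kt).marg (covariates x n) (responses y n m ω)) atTop (𝓝 0) := by
      refine ae_all_iff.2 fun k => eventually_imp_distrib_left.2 fun hk => ?_
      simpa [RegModel.marg] using (hS kt m hm).ae_tendsto_div_marg hx hy hlaw (hS k m hm)
        MeasurableSet.univ (hle k m hm) (hkt k hk m hm)
    filter_upwards [hratio, (hS kt m hm).ae_eventually_marg_ne_zero,
      ae_all_iff.2 fun k => (hS k m hm).ae_eventually_marg_ne_top hx hy hlaw] with ω h1 h2 h3
    exact tendsto_postModel M ρ (fun k => ne_top_of_le_ne_top ENNReal.one_ne_top (hρle k)) hρkt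
      (covariates x) (fun n => responses y n m ω) h3 h2 h1
  have hparam : ∀ᵐ ω ∂P, ∀ m ≥ 1, Tendsto (fun n =>
      (M kt).post (covariates x n) (responses y n m ω) (Θt kt)ᶜ) atTop (𝓝 0) :=
    ae_all_iff.2 fun m => eventually_imp_distrib_left.2 fun hm =>
      (hS kt m hm).ae_tendsto_div_marg hx hy hlaw (hS kt m hm) (hΘt kt).compl le_rfl
        (hΘtmin kt m hm)
  obtain ⟨C, hC⟩ := (M kt).exists_xTildePost_le h𝒳 (D kt) c hc'
  have hClim : Tendsto (fun n : ℕ => ENNReal.ofReal (C / (ε / 4) ^ 2 / n)) atTop (𝓝 0) := by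
    rw [← ENNReal.ofReal_zero]
    exact ENNReal.tendsto_ofReal (tendsto_const_div_atTop_nhds_zero_nat _)
  have hβ01 (p : ℕ × ℕ) : 0 < lam p.1 p.2 / (1 + lam p.1 p.2) ∧
      lam p.1 p.2 / (1 + lam p.1 p.2) < 1 := by
    have := hlam p.1 p.2
    exact ⟨by positivity, by rw [div_lt_one (by positivity)]; linarith⟩
  -- The thresholds eventually lie in `(b₀, b₁)` with `0 < b₀` and `b₁ < 1`, jointly in `n` and `m`.
  obtain ⟨b₀, hb₀, hb₀'⟩ := exists_between hβinf
  obtain ⟨b₁, hb₁, hb₁'⟩ := exists_between hβsup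
  have hβ := (eventually_lt_of_lt_liminf hb₀'
    (isBoundedUnder_of ⟨0, fun p => (hβ01 p).1.le⟩)).and
    (eventually_lt_of_limsup_lt hb₁ (isBoundedUnder_of ⟨1, fun p => (hβ01 p).2.le⟩))
  rw [prod_atTop_atTop_eq, eventually_atTop] at hβ
  obtain ⟨⟨N, N'⟩, hN⟩ := hβ
  filter_upwards [hmodel, hparam, hcv, hcred, ha kt] with ω hmodel hparam hcv hcred ⟨L, hL, hLa⟩
  -- For each large `m` the decision is eventually constant in `n`, so the inner limits equal 1.
  refine ⟨fun _ => 1, ?_, tendsto_const_nhds⟩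
  filter_upwards [hL, (Metric.tendsto_nhds.1 hLa) (ε / 4) (by positivity), eventually_gt_atTop 1,
    eventually_ge_atTop N'] with m hmL hmL' hm1 hmN
  have hsum := (((hmodel m hm1.le).2.add (hparam m hm1.le)).add hClim).eventually_lt_const
    (u := ENNReal.ofReal b₀) (by simpa using hb₀)
  refine tendsto_const_nhds.congr' ?_
  filter_upwards [Metric.tendsto_nhds.1 hmL (ε / 4) (by positivity), eventually_gt_atTop 1,
    eventually_ge_atTop N, hsum,
    (hmodel m hm1.le).1.eventually_const_lt (u := ENNReal.ofReal b₁) (by simpa using hb₁'),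
    hClim.eventually_lt_const (u := ENNReal.ofReal (1 - α)) (by simpa using hα.2)]
    with n hnT hn1 hnN hnsum hnmodel hnC
  obtain ⟨hβ0, hβ1⟩ := hN (n, m) ⟨hnN, hmN⟩
  symm
  refine decisionRule_bestDecision_eq_one (le_of_lt ?_) fun k hk => ?_
  · refine lt_trans (postAlt_lt M ρ Θt D c c' _ _ _ _ (lt_of_le_of_lt ?_ hnsum)) hβ0
    have hconc := hC n (by lia) m (covariates x n) (responses y n m ω) (Θt kt)
      (hcv kt n hn1 m hm1) (ε / 4) (by positivity)
    gcongr
    -- For large `n` the Chebyshev bound is below `1 - α`, hence below the mass of the credible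
    -- interval.
    refine (measure_sub_notMem_Icc_le _ _ ?_
      ((hconc.trans_lt hnC).trans_le (hcred kt n hn1 m hm1))).trans hconc
    rw [← Real.dist_eq]
    -- One `ε / 4` comes from the limit in `n`, the other from the limit in `m`.
    refine (dist_triangle _ (L m) _).trans_lt ?_
    linarith
  · refine lt_of_lt_of_le ?_ (postModel_le_postAlt M ρ Θt D c c' _ _ _ _ hk.symm
      (hcv k n hn1 m hm1))
    refine hβ1.trans ?_
    exact (ENNReal.ofReal_lt_iff_lt_toReal ((hβ01 (n, m)).1.trans hβ1).le
      (ne_top_of_le_ne_top ENNReal.one_ne_top (postModel_le_one M ρ _ _ _))).1 hnmodel
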